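/- Let $k\ge 1$ and let $N_1,\dots,N_k\ge 2$ be integers; write $\mathbf N=(N_1,\dots,N_k)$. For an integer $N\ge 1$ let $r_1,\dots,r_{\varphi(N)}$ be the integers in $\{1,\dots,N\}$ coprime to $N$ ($\varphi$ is Euler's totient function), let $C_N=N^{\varphi(N)}\prod_{p\mid N}p^{\varphi(N)/(p-1)}$ (product over the primes dividing $N$), and for $m\ge 0$ put $$\mathbf B_N(m)=C_N^m\prod_{j=1}^{\varphi(N)}\frac{(r_j/N)_m}{m!},\qquad \mathbf H_N(m)=\sum_{j=1}^{\varphi(N)}H(r_j/N,m)-\varphi(N)H(1,m),$$ where $(x)_m=x(x+1)\cdots(x+m-1)$ and $H(x,m)=\sum_{n=0}^{m-1}\frac1{x+n}$. Put $C_{\mathbf N}=\prod_{j}C_{N_j}$, $\Phi_{\mathbf N}=\sum_j\varphi(N_j)$, $\mathbf B_{\mathbf N}(m)=\prod_j\mathbf B_{N_j}(m)$, $\mathbf H_{\mathbf N}(m)=\sum_j\mathbf H_{N_j}(m)$, and, for complex $z$ with $|z|<1/C_{\mathbf N}$, $$\mathbf F_{\mathbf N}(z)=\sum_{m\ge0}\mathbf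 B_{\mathbf N}(m)z^m,\qquad \mathbf G_{\mathbf N}(z)=\sum_{m\ge1}\mathbf H_{\mathbf N}(m)\mathbf B_{\mathbf N}(m)z^m,\qquad \mathbf q_{\mathbf N}(z)=z\exp\big(\mathbf G_{\mathbf N}(z)/\mathbf F_{\mathbf N}(z)\big).$$ Then the following assertions hold. (i) The function $\mathbf q_{\mathbf N}$ is the sum of its Taylor series at $0$ on the disk $|z|<1/C_{\mathbf N}$; the radius of convergence of this Taylor series is equal to $1/C_{\mathbf N}$, and the series converges (absolutely) for every $z$ with $|z|=1/C_{\mathbf N}$. (ii) The function $\mathbf q_{\mathbf N}$ has a singularity at $z=1/C_{\mathbf N}$: no function analytic at $1/C_{\mathbf N}$ agrees with $\mathbf q_{\mathbf N}$ at the points of the disk $|z|<1/C_{\mathbf N}$ close to $1/C_{\mathbf N}$. (iii) For every $z$ with $|z|\le 1/C_{\mathbf N}$ we have $|\mathbf q_{\mathbf N}(z)|\le 1$, where for $|z|=1/C_{\mathbf N}$ the value $\mathbf q_{\mathbf N}(z)$ is the sum of the Taylor series at $z$, which is also the limit of $\mathbf q_{\mathbf N}$ at $z$ from inside the disk. (iv)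 If $\Phi_{\mathbf N}=1$ (that is, $\mathbf N=(2)$), then for $m\ge1$ the $m$-th Taylor coefficient of $\mathbf q_{\mathbf N}$ at $0$ is equal to the Catalan number $\frac1{m+1}\binom{2m}{m}$, and, hence, as $m\to\infty$, it is equal to $\frac{4^m}{\sqrt\pi\,m^{3/2}}(1+o(1))$. (v) If $\Phi_{\mathbf N}=2$, then there is a non-zero real constant $c$ (depending on $\mathbf N$) such that, as $m\to\infty$, the $m$-th Taylor coefficient of $\mathbf q_{\mathbf N}$ at $0$ is equal to $c\,\frac{C_{\mathbf N}^m}{m\log^2(m)}(1+o(1))$. (vi) If $\Phi_{\mathbf N}\ge3$, then there is a non-zero real constant $c$ (depending on $\mathbf N$) such that, as $m\to\infty$, the $m$-th Taylor coefficient of $\mathbf q_{\mathbf N}$ at $0$ is equal to $c\,\frac{C_{\mathbf N}^m}{m^{\Phi_{\mathbf N}/2}}(1+o(1))$. -/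

import Mathlib

open Filter Topology Asymptotics

noncomputable section

namespace CanonicalCoordinate

/-- The integers in `{1, ..., n}` coprime to `n`; there are `φ(n)` of them. -/
def residues (n : ℕ) : Finset ℕ :=
  (Finset.Icc 1 n).filter (fun r => Nat.Coprime r n)

/-- `C_n = n ^ φ(n) * ∏_{p ∣ n} p ^ (φ(n) / (p - 1))`. For a prime `p ∣ n` the number `p - 1`
divides `φ(n)`, so the division is exact. -/
def C1 (n : ℕ) : ℕ :=
  n ^ n.totient * ∏ p ∈ n.primeFactors, p ^ (n.totient / (p - 1))

/-- `B_n(m) = C_n ^ m * ∏_r (r/n)_m / m!`, with `(x)_m = x (x + 1) ⋯ (x + m - 1)`. -/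
def B1 (n m : ℕ) : ℝ :=
  (C1 n : ℝ) ^ m *
    ∏ r ∈ residues n, (ascPochhammer ℝ m).eval ((r : ℝ) / (n : ℝ)) / (m.factorial : ℝ)

/-- `H(x, m) = ∑_{0 ≤ i < m} 1 / (x + i)`. -/
def harm (x : ℝ) (m : ℕ) : ℝ :=
  ∑ i ∈ Finset.range m, 1 / (x + (i : ℝ))

/-- `H_n(m) = ∑_r H(r/n, m) - φ(n) H(1, m)`. -/
def H1 (n m : ℕ) : ℝ :=
  ∑ r ∈ residues n, harm ((r : ℝ) / (n : ℝ)) m - (n.totient : ℝ) * harm 1 m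

/-- `C_N = C_{N_1} ⋯ C_{N_k}`. -/
def C {k : ℕ} (N : Fin k → ℕ) : ℕ := ∏ j, C1 (N j)

/-- `Φ_N = φ(N_1) + ⋯ + φ(N_k)`. -/
def Phi {k : ℕ} (N : Fin k → ℕ) : ℕ := ∑ j, (N j).totient

/-- `B_N(m) = B_{N_1}(m) ⋯ B_{N_k}(m)`. -/
def B {k : ℕ} (N : Fin k → ℕ) (m : ℕ) : ℝ := ∏ j, B1 (N j) m

/-- `H_N(m) = H_{N_1}(m) + ⋯ + H_{N_k}(m)`. -/
def H {k : ℕ} (N : Fin k → ℕ) (m : ℕ) : ℝ := ∑ j, H1 (N j) m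

/-- `F_N(z) = ∑_{m ≥ 0} B_N(m) z ^ m`, meant for `|z| < 1 / C_N`. -/
def F {k : ℕ} (N : Fin k → ℕ) (z : ℂ) : ℂ := ∑' m : ℕ, (B N m : ℂ) * z ^ m

/-- `G_N(z) = ∑_{m ≥ 1} H_N(m) B_N(m) z ^ m`, meant for `|z| < 1 / C_N`
(the term `m = 0` vanishes because `H_N(0) = 0`). -/
def G {k : ℕ} (N : Fin k → ℕ) (z : ℂ) : ℂ :=
  ∑' m : ℕ, (H N m : ℂ) * (B N m : ℂ) * z ^ m

/-- The canonical coordinate `q_N(z) = z exp(G_N(z) / F_N(z))`, meant for `|z| < 1 / C_N`. -/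
def q {k : ℕ} (N : Fin k → ℕ) (z : ℂ) : ℂ := z * Complex.exp (G N z / F N z)

/-- The `m`-th Taylor coefficient of a function at `0`. -/
def taylorCoeff (f : ℂ → ℂ) (m : ℕ) : ℂ := iteratedDeriv m f 0 / (m.factorial : ℂ)

/-- The Taylor series of a function at `0`. -/
def taylorSeries (f : ℂ → ℂ) : FormalMultilinearSeries ℂ ℂ ℂ :=
  FormalMultilinearSeries.ofScalars ℂ (taylorCoeff f)

/-- A function `f` on `D` has a singularity at the boundary point `z₀` of `D`: no function that is
analytic at `z₀` agrees with `f` on the part of `D` near `z₀`. -/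
def HasSingularityAt (f : ℂ → ℂ) (D : Set ℂ) (z₀ : ℂ) : Prop :=
  z₀ ∈ frontier D ∧ ¬ ∃ g : ℂ → ℂ, AnalyticAt ℂ g z₀ ∧ f =ᶠ[𝓝[D] z₀] g

end CanonicalCoordinate

end

/-!
After rescaling the variable by `C_N`, the coefficients `bₘ` of `F_N` are the products
`∏ᵢ (xᵢ)ₘ / m!` over the parameters `xᵢ = r / N_j ∈ (0, 1)`, a decreasing log-convex sequence. By
Kaluza's theorem `1 / F_N = 1 - ∑ aₙ zⁿ` with `aₙ ≥ 0`. The harmonic factors `hₘ` increase from `0`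
to `log C_N`, so the coefficients of `G_N / F_N` are also nonnegative, and their sum is at most
`log C_N`. Hence `exp (G_N / F_N)` has nonnegative coefficients of sum at most `C_N`; this bounds
`q_N` by `1` and makes its Taylor series converge absolutely on the closed disk.

Since `r ↦ N_j - r` preserves the residues, `∑ᵢ xᵢ = Φ_N / 2` and so `bₙ ~ κ n ^ (-Φ_N / 2)`. For
`Φ_N ≥ 3` this is a summable weight, and the asymptotics survive taking reciprocals, quotients and
exponentials. For `Φ_N = 2` the series `∑ bₙ` diverges logarithmically: the tails `1 - a₀ - ⋯ - aₙ`
are asymptotic to `1 / (κ log n)`. With `A = ∑ aₙ zⁿ` and `T` the generating function of the tails,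
the identity `z A' = (1 - z) z F_N' · T / F_N` turns this into `aₙ ~ 1 / (κ n log² n)`, and this
weight is summable. For `Φ_N = 1` the function `exp (G_N / F_N)` is the square of the generating
function of the Catalan numbers.

If `q_N` continued analytically past `1 / C_N`, then by Pringsheim's theorem its coefficients,
rescaled, would decay faster than every power of `n`, contrary to these asymptotics.
-/

noncomputable section

namespace CanonicalCoordinate

open PowerSeries
open Finset (range)
open Finset.HasAntidiagonal (antidiagonal)

section Tempered

/-- Weight sequences against which the growth of coefficients is measured: consecutive terms are
asymptotically equal, and the terms between `n / 2` and `n` are bounded by a multiple of the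
`n`-th one, so that both halves of a convolution can be compared with its last term. -/
structure IsTempered (v : ℕ → ℝ) : Prop where
  pos : ∀ n, 0 < v n
  ratio : Tendsto (fun n => v (n + 1) / v n) atTop (𝓝 1)
  doubling : ∃ K, 0 ≤ K ∧ ∀ ⦃j n⦄, j ≤ n → n ≤ 2 * j → v j ≤ K * v n

variable {u v w x y : ℕ → ℝ} {α β : ℝ}

lemma exists_abs_le_of_isBigO (hw : ∀ n, 0 < w n) (h : x =O[atTop] w) :
    ∃ M, 0 ≤ M ∧ ∀ n, |x n| ≤ M * w n := by
  obtain ⟨M, hM, hbound⟩ := bound_of_isBigO_nat_atTop h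
  exact ⟨M, hM.le, fun n => by simpa [abs_of_pos (hw n)] using hbound (hw n).ne'⟩

lemma isBigO_of_tendsto_div (hw : ∀ n, 0 < w n) (h : Tendsto (fun n => x n / w n) atTop (𝓝 α)) :
    x =O[atTop] w :=
  isBigO_of_div_tendsto_nhds (Eventually.of_forall fun n hn => absurd hn (hw n).ne') α h

lemma isBigO_of_tendsto_div_ne_zero (hα : α ≠ 0) (h : Tendsto (fun n => x n / w n) atTop (𝓝 α)) :
    w =O[atTop] x := by
  refine isBigO_of_div_tendsto_nhds ?_ α⁻¹ ((h.inv₀ hα).congr fun n => inv_div _ _)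
  filter_upwards [h.eventually_ne hα] with n hn hzero
  simp [hzero] at hn

lemma tendsto_zero_of_tendsto_div (hw : ∀ n, 0 < w n) (hw0 : Tendsto w atTop (𝓝 0))
    (h : Tendsto (fun n => x n / w n) atTop (𝓝 α)) : Tendsto x atTop (𝓝 0) :=
  (isBigO_of_tendsto_div hw h).trans_tendsto hw0

lemma tendsto_cesaro_abs_of_tendsto_zero (hx : Tendsto x atTop (𝓝 0)) :
    Tendsto (fun n : ℕ => (∑ j ∈ range (n + 1), |x j|) / ((n : ℝ) + 1)) atTop (𝓝 0) := by
  have h := (abs_zero (α := ℝ) ▸ hx.abs).cesaro.comp (tendsto_add_atTop_nat 1)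
  refine h.congr fun n => ?_
  simp only [Function.comp, Nat.cast_add, Nat.cast_one]
  rw [mul_comm, div_eq_mul_inv]

namespace IsTempered

lemma tendsto_sub_div (hv : IsTempered v) (j : ℕ) :
    Tendsto (fun n => v (n - j) / v n) atTop (𝓝 1) := by
  have hadd : Tendsto (fun n => v n / v (n + j)) atTop (𝓝 1) := by
    induction j with
    | zero => simp [div_self (hv.pos _).ne']
    | succ j ih =>
      have hstep := (hv.ratio.comp (tendsto_add_atTop_nat j)).inv₀ one_ne_zero
      have hmul := ih.mul hstep
      simp only [inv_one, mul_one] at hmul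
      refine hmul.congr fun n => ?_
      have := (hv.pos (n + j)).ne'
      simp only [Function.comp, ← add_assoc]
      field_simp
  refine (hadd.comp (tendsto_sub_atTop_nat j)).congr' ?_
  filter_upwards [eventually_ge_atTop j] with n hn
  simp [Nat.sub_add_cancel hn]

lemma mul (hv : IsTempered v) (hw : IsTempered w) : IsTempered fun n => v n * w n where
  pos n := mul_pos (hv.pos n) (hw.pos n)
  ratio := by
    simpa only [one_mul, mul_div_mul_comm] using hv.ratio.mul hw.ratio
  doubling := by
    obtain ⟨K, hK0, hK⟩ := hv.doubling
    obtain ⟨L, hL0, hL⟩ := hw.doubling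
    refine ⟨K * L, mul_nonneg hK0 hL0, fun j n hjn hnj => ?_⟩
    rw [mul_mul_mul_comm]
    exact mul_le_mul (hK hjn hnj) (hL hjn hnj) (hw.pos j).le (mul_nonneg hK0 (hv.pos n).le)

end IsTempered

lemma tendsto_natCast_div_natCast_add_one :
    Tendsto (fun n : ℕ => (n : ℝ) / ((n : ℝ) + 1)) atTop (𝓝 1) :=
  tendsto_natCast_div_add_atTop 1

lemma isTempered_rpow (s : ℝ) : IsTempered fun n : ℕ => ((n : ℝ) + 1) ^ s where
  pos n := by positivity
  ratio := by
    have hratio : Tendsto (fun n : ℕ => 1 + 1 / ((n : ℝ) + 1)) atTop (𝓝 1) := by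
      simpa using (tendsto_one_div_add_atTop_nhds_zero_nat (𝕜 := ℝ)).const_add 1
    refine (Real.one_rpow s ▸ hratio.rpow_const (Or.inl one_ne_zero)).congr fun n => ?_
    rw [← Real.div_rpow (by positivity) (by positivity)]
    congr 1
    push_cast
    field_simp
  doubling := by
    refine ⟨2 ^ |s|, by positivity, fun j n hjn hnj => ?_⟩
    have hjn' : (j : ℝ) + 1 ≤ n + 1 := by gcongr
    have hnj' : (n : ℝ) + 1 ≤ 2 * (j + 1) := by
      have : (n : ℝ) ≤ 2 * j := by exact_mod_cast hnj
      linarith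
    rcases le_total 0 s with hs | hs
    · exact (Real.rpow_le_rpow (by positivity) hjn' hs).trans
        (le_mul_of_one_le_left (by positivity) (Real.one_le_rpow one_le_two (abs_nonneg s)))
    · calc ((j : ℝ) + 1) ^ s = 2 ^ |s| * (2 * ((j : ℝ) + 1)) ^ s := by
            rw [Real.mul_rpow zero_le_two (by positivity), ← mul_assoc, ← Real.rpow_add two_pos,
              abs_of_nonpos hs, neg_add_cancel, Real.rpow_zero, one_mul]
        _ ≤ 2 ^ |s| * ((n : ℝ) + 1) ^ s := by
            gcongr 2 ^ |s| * ?_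
            exact Real.rpow_le_rpow_of_nonpos (by positivity) hnj' hs

lemma IsTempered.succ_mul (hv : IsTempered v) : IsTempered fun n : ℕ => ((n : ℝ) + 1) * v n := by
  simpa only [Real.rpow_one] using (isTempered_rpow 1).mul hv

lemma IsTempered.div_succ (hv : IsTempered v) : IsTempered fun n : ℕ => v n / ((n : ℝ) + 1) := by
  simpa only [Real.rpow_neg_one, inv_mul_eq_div] using (isTempered_rpow (-1)).mul hv

end Tempered

section Convolution

variable {u v w x y : ℕ → ℝ} {α β : ℝ} {f g : ℝ⟦X⟧}

lemma coeff_mul_eq_sum_half_add_sum_half (f g : ℝ⟦X⟧) (n : ℕ) :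
    coeff n (f * g) = ∑ j ∈ range (n / 2 + 1), coeff j f * coeff (n - j) g +
      ∑ j ∈ range ((n + 1) / 2), coeff j g * coeff (n - j) f := by
  rw [coeff_mul, Finset.Nat.sum_antidiagonal_eq_sum_range_succ fun i j => coeff i f * coeff j g,
    show n.succ = n / 2 + 1 + (n + 1) / 2 by omega, Finset.sum_range_add]
  congr 1
  rw [← Finset.sum_range_reflect]
  refine Finset.sum_congr rfl fun j hj => ?_
  rw [Finset.mem_range] at hj
  rw [show n / 2 + 1 + ((n + 1) / 2 - 1 - j) = n - j by omega, show n - (n - j) = j by omega,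
    mul_comm]

lemma tendsto_sum_mul_sub_div (hv : IsTempered v) (hx : Summable x)
    (hy : Tendsto (fun n => y n / v n) atTop (𝓝 β)) {r : ℕ → ℕ} (hr : Tendsto r atTop atTop)
    (hr' : ∀ ⦃n j⦄, j < r n → 2 * j ≤ n) :
    Tendsto (fun n => (∑ j ∈ range (r n), x j * y (n - j)) / v n) atTop (𝓝 (β * ∑' j, x j)) := by
  obtain ⟨M, hM0, hM⟩ := exists_abs_le_of_isBigO hv.pos (isBigO_of_tendsto_div hv.pos hy)
  obtain ⟨K, hK0, hK⟩ := hv.doubling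
  have hlim : Tendsto (fun n => ∑' j, if j < r n then x j * y (n - j) / v n else 0) atTop
      (𝓝 (∑' j, x j * β)) := by
    refine tendsto_tsum_of_dominated_convergence (hx.abs.mul_right (M * K)) (fun j => ?_)
      (Eventually.of_forall fun n j => ?_)
    · have hterm := ((hy.comp (tendsto_sub_atTop_nat j)).mul (hv.tendsto_sub_div j)).const_mul (x j)
      rw [mul_one] at hterm
      refine hterm.congr' ?_
      filter_upwards [hr.eventually_gt_atTop j] with n hn
      have := (hv.pos (n - j)).ne'
      simp only [if_pos hn, Function.comp]
      field_simp
    · split_ifs with hj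
      · have h2j := hr' hj
        rw [Real.norm_eq_abs, abs_div, abs_mul, abs_of_pos (hv.pos n), mul_div_assoc]
        gcongr
        rw [div_le_iff₀ (hv.pos n), mul_assoc]
        exact (hM _).trans (mul_le_mul_of_nonneg_left (hK (by omega) (by omega)) hM0)
      · simp only [norm_zero]; positivity
  rw [tsum_mul_right, mul_comm] at hlim
  refine hlim.congr fun n => ?_
  rw [tsum_eq_sum (s := range (r n)) fun j hj => if_neg (by simpa using hj), Finset.sum_div]
  exact Finset.sum_congr rfl fun j hj => if_pos (Finset.mem_range.1 hj)

lemma abs_sum_mul_sub_le {n r : ℕ} {Y : ℝ} (h : ∀ j < r, x j ≠ 0 → |y (n - j)| ≤ Y) :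
    |∑ j ∈ range r, x j * y (n - j)| ≤ (∑ j ∈ range r, |x j|) * Y := by
  rw [Finset.sum_mul]
  refine (Finset.abs_sum_le_sum_abs _ _).trans (Finset.sum_le_sum fun j hj => ?_)
  rw [abs_mul]
  rcases eq_or_ne (x j) 0 with hx | hx
  · simp [hx]
  · exact mul_le_mul_of_nonneg_left (h j (Finset.mem_range.1 hj) hx) (abs_nonneg _)

lemma sum_range_abs_le_of_le {m n : ℕ} (x : ℕ → ℝ) (hmn : m ≤ n) :
    ∑ j ∈ range m, |x j| ≤ ∑ j ∈ range n, |x j| :=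
  Finset.sum_le_sum_of_subset_of_nonneg (Finset.range_subset_range.2 hmn) fun _ _ _ => abs_nonneg _

lemma tendsto_half_add_one : Tendsto (fun n : ℕ => n / 2 + 1) atTop atTop :=
  tendsto_atTop.2 fun b => (eventually_ge_atTop (2 * b)).mono fun n hn => by omega

lemma tendsto_add_one_half : Tendsto (fun n : ℕ => (n + 1) / 2) atTop atTop :=
  tendsto_atTop.2 fun b => (eventually_ge_atTop (2 * b)).mono fun n hn => by omega

lemma tendsto_coeff_mul_div (hw : IsTempered w) (hws : Summable w)
    (hf : Tendsto (fun n => coeff n f / w n) atTop (𝓝 α))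
    (hg : Tendsto (fun n => coeff n g / w n) atTop (𝓝 β)) :
    Tendsto (fun n => coeff n (f * g) / w n) atTop
      (𝓝 (β * ∑' j, coeff j f + α * ∑' j, coeff j g)) := by
  have hfs := summable_of_isBigO_nat hws (isBigO_of_tendsto_div hw.pos hf)
  have hgs := summable_of_isBigO_nat hws (isBigO_of_tendsto_div hw.pos hg)
  have hlow := tendsto_sum_mul_sub_div hw hfs hg tendsto_half_add_one fun n j h => by omega
  have hhigh := tendsto_sum_mul_sub_div hw hgs hf tendsto_add_one_half fun n j h => by omega
  refine (hlow.add hhigh).congr fun n => ?_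
  rw [coeff_mul_eq_sum_half_add_sum_half, add_div]

lemma tendsto_coeff_mul_div_of_isBigO (hu : IsTempered u) (hus : Summable u) (hv : IsTempered v)
    (hv0 : Tendsto v atTop (𝓝 0)) (huv : (fun n : ℕ => ((n : ℝ) + 1) * u n) =O[atTop] v)
    (hf : (fun n => coeff n f) =O[atTop] u)
    (hg : Tendsto (fun n => coeff n g / v n) atTop (𝓝 β)) :
    Tendsto (fun n => coeff n (f * g) / v n) atTop (𝓝 (β * ∑' j, coeff j f)) := by
  have hlow := tendsto_sum_mul_sub_div hv (summable_of_isBigO_nat hus hf) hg tendsto_half_add_one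
    fun n j h => by omega
  have hhigh : Tendsto (fun n => (∑ j ∈ range ((n + 1) / 2), coeff j g * coeff (n - j) f) / v n)
      atTop (𝓝 0) := by
    obtain ⟨M, hM0, hM⟩ := exists_abs_le_of_isBigO hu.pos hf
    obtain ⟨K, hK0, hK⟩ := hu.doubling
    obtain ⟨A, -, hA⟩ := exists_abs_le_of_isBigO hv.pos huv
    have hcesaro := (tendsto_cesaro_abs_of_tendsto_zero
      (tendsto_zero_of_tendsto_div hv.pos hv0 hg)).mul_const (M * K * A)
    rw [zero_mul] at hcesaro
    refine squeeze_zero_norm (fun n => ?_) hcesaro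
    have huvn : u n / v n ≤ A / (n + 1) := by
      rw [div_le_div_iff₀ (hv.pos n) (by positivity), mul_comm]
      exact (le_abs_self _).trans (hA n)
    calc ‖(∑ j ∈ range ((n + 1) / 2), coeff j g * coeff (n - j) f) / v n‖
        ≤ (∑ j ∈ range ((n + 1) / 2), |coeff j g|) * (M * (K * u n)) / v n := by
          rw [norm_div, Real.norm_of_nonneg (hv.pos n).le]
          refine div_le_div_of_nonneg_right ?_ (hv.pos n).le
          refine abs_sum_mul_sub_le (x := fun n => coeff n g) (y := fun n => coeff n f)
            (Y := M * (K * u n)) fun j hj _ => (hM _).trans ?_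
          exact mul_le_mul_of_nonneg_left (hK (by omega) (by omega)) hM0
      _ ≤ (∑ j ∈ range (n + 1), |coeff j g|) * (M * K * (A / (n + 1))) := by
          rw [mul_div_assoc, ← mul_assoc M, mul_div_assoc (M * K)]
          exact mul_le_mul (sum_range_abs_le_of_le _ (by omega))
            (mul_le_mul_of_nonneg_left huvn (by positivity))
            (mul_nonneg (by positivity) (div_pos (hu.pos n) (hv.pos n)).le) (by positivity)
      _ = (∑ j ∈ range (n + 1), |coeff j g|) / (n + 1) * (M * K * A) := by ring
  refine (add_zero (β * ∑' j, coeff j f) ▸ hlow.add hhigh).congr fun n => ?_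
  rw [coeff_mul_eq_sum_half_add_sum_half, add_div]

lemma coeff_X_mul_derivative {R : Type*} [CommRing R] (f : R⟦X⟧) (n : ℕ) :
    coeff n (X * d⁄dX R f) = n * coeff n f := by
  rcases n with _ | n
  · simp
  · rw [coeff_succ_X_mul, coeff_derivative, Nat.cast_succ, mul_comm]

lemma tendsto_coeff_X_mul_derivative_div_iff (hw : ∀ n, 0 < w n) :
    Tendsto (fun n : ℕ => coeff n (X * d⁄dX ℝ f) / (((n : ℝ) + 1) * w n)) atTop (𝓝 α) ↔
      Tendsto (fun n => coeff n f / w n) atTop (𝓝 α) := by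
  constructor <;> intro h
  · have hdiv := h.div tendsto_natCast_div_natCast_add_one one_ne_zero
    rw [div_one] at hdiv
    refine hdiv.congr' ?_
    filter_upwards [eventually_gt_atTop 0] with n hn
    have := hw n
    simp only [coeff_X_mul_derivative, Pi.div_apply]
    field_simp
  · refine (one_mul α ▸ tendsto_natCast_div_natCast_add_one.mul h).congr fun n => ?_
    rw [coeff_X_mul_derivative, div_mul_div_comm]

lemma exists_forall_le_of_eventually_le_half_add {r : ℕ → ℝ} {A : ℝ}
    (h : ∀ᶠ n in atTop, ∀ R, 0 ≤ R → (∀ m < n, r m ≤ R) → r n ≤ R / 2 + A) :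
    ∃ R, 0 ≤ R ∧ ∀ n, r n ≤ R := by
  obtain ⟨n₀, hn₀⟩ := eventually_atTop.1 h
  refine ⟨2 * |A| + ∑ n ∈ range n₀, |r n|, by positivity, fun n => ?_⟩
  induction n using Nat.strong_induction_on with
  | _ n ih =>
    have hsum : 0 ≤ ∑ n ∈ range n₀, |r n| := by positivity
    rcases lt_or_ge n n₀ with hn | hn
    · have hle := Finset.single_le_sum (f := fun n => |r n|) (fun n _ => abs_nonneg _)
        (Finset.mem_range.2 hn)
      linarith [le_abs_self (r n), abs_nonneg A]
    · linarith [hn₀ n hn _ (by positivity) ih, le_abs_self A]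

lemma abs_coeff_mul_le {n : ℕ} {Y Z : ℝ} (hY : 0 ≤ Y) (hZ : 0 ≤ Z)
    (hg : ∀ j, 2 * j ≤ n → coeff j f ≠ 0 → |coeff (n - j) g| ≤ Y)
    (hf : ∀ j, 2 * j ≤ n → coeff j g ≠ 0 → |coeff (n - j) f| ≤ Z) :
    |coeff n (f * g)| ≤
      (∑ j ∈ range (n + 1), |coeff j f|) * Y + (∑ j ∈ range (n + 1), |coeff j g|) * Z := by
  rw [coeff_mul_eq_sum_half_add_sum_half]
  refine (abs_add_le _ _).trans (add_le_add ?_ ?_)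
  · refine (abs_sum_mul_sub_le (x := fun n => coeff n f) (y := fun n => coeff n g)
      fun j hj => hg j (by omega)).trans (mul_le_mul_of_nonneg_right ?_ hY)
    exact sum_range_abs_le_of_le _ (by omega)
  · refine (abs_sum_mul_sub_le (x := fun n => coeff n g) (y := fun n => coeff n f)
      fun j hj => hf j (by omega)).trans (mul_le_mul_of_nonneg_right ?_ hZ)
    exact sum_range_abs_le_of_le _ (by omega)

lemma isBigO_coeff_of_derivative_eq_mul (hw : IsTempered w)
    (hw0 : Tendsto (fun n : ℕ => ((n : ℝ) + 1) * w n) atTop (𝓝 0))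
    (hg : (fun n => coeff n (X * d⁄dX ℝ g)) =O[atTop] fun n : ℕ => ((n : ℝ) + 1) * w n)
    (hf : Summable fun n => coeff n f) (h : d⁄dX ℝ f = d⁄dX ℝ g * f) :
    (fun n => coeff n f) =O[atTop] w := by
  obtain ⟨M, hM0, hM⟩ := exists_abs_le_of_isBigO hw.succ_mul.pos hg
  obtain ⟨K, hK0, hK⟩ := hw.doubling
  obtain ⟨L, hL0, hL⟩ := hw.succ_mul.doubling
  set S := ∑' j, |coeff j f|
  have hcesaro : ∀ᶠ n : ℕ in atTop,
      (∑ j ∈ range (n + 1), |coeff j (X * d⁄dX ℝ g)|) / ((n : ℝ) + 1) * (4 * K) ≤ 1 :=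
    ((tendsto_cesaro_abs_of_tendsto_zero (hg.trans_tendsto hw0)).mul_const
      (4 * K)).eventually_le_const (by norm_num)
  suffices hbdd : ∃ R, 0 ≤ R ∧ ∀ n, |coeff n f| / w n ≤ R by
    obtain ⟨R, -, hR⟩ := hbdd
    refine IsBigO.of_bound R (Eventually.of_forall fun n => ?_)
    rw [Real.norm_eq_abs, Real.norm_of_nonneg (hw.pos n).le]
    exact (div_le_iff₀ (hw.pos n)).1 (hR n)
  refine exists_forall_le_of_eventually_le_half_add (A := 2 * S * (M * L)) ?_
  filter_upwards [hcesaro, eventually_ge_atTop 1] with n hn hn1 R hR0 hR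
  have hwn := hw.pos n
  have hcoeff := abs_coeff_mul_le (f := X * d⁄dX ℝ g) (g := f) (n := n) (Y := R * (K * w n))
    (Z := M * (L * ((n + 1) * w n))) (by positivity) (by positivity)
    (fun j hj hxj => by
      have hj0 : j ≠ 0 := by rintro rfl; simp at hxj
      exact ((div_le_iff₀ (hw.pos _)).1 (hR (n - j) (by omega))).trans
        (mul_le_mul_of_nonneg_left (hK (by omega) (by omega)) hR0))
    (fun j hj _ => (hM _).trans (mul_le_mul_of_nonneg_left (hL (by omega) (by omega)) hM0))
  have hS : ∑ j ∈ range (n + 1), |coeff j f| ≤ S := hf.abs.sum_le_tsum _ fun _ _ => abs_nonneg _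
  rw [mul_assoc, ← h, coeff_X_mul_derivative, abs_mul, Nat.abs_cast] at hcoeff
  have hhalf : ((n : ℝ) + 1) / 2 ≤ n := by
    have : (1 : ℝ) ≤ n := by exact_mod_cast hn1
    linarith
  rw [div_mul_eq_mul_div, div_le_one (by positivity)] at hn
  rw [div_le_iff₀ hwn]
  refine le_of_mul_le_mul_left ?_ (show 0 < ((n : ℝ) + 1) / 2 by positivity)
  calc ((n : ℝ) + 1) / 2 * |coeff n f| ≤ n * |coeff n f| := by gcongr
    _ ≤ _ := hcoeff
    _ = (∑ j ∈ range (n + 1), |coeff j (X * d⁄dX ℝ g)|) * (4 * K) * (R / 4 * w n) +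
          (∑ j ∈ range (n + 1), |coeff j f|) * (M * (L * ((n + 1) * w n))) := by ring
    _ ≤ ((n : ℝ) + 1) * (R / 4 * w n) + S * (M * (L * ((n + 1) * w n))) := by gcongr
    _ = ((n : ℝ) + 1) / 2 * ((R / 2 + 2 * S * (M * L)) * w n) := by ring

end Convolution

section Kaluza

/-- Kaluza's hypothesis on the coefficients of a power series: a positive, decreasing, log-convex
sequence starting at `1`. Kaluza's theorem is `IsKaluza.coeff_recipDefect_nonneg`. -/
structure IsKaluza (b : ℕ → ℝ) : Prop where
  zero : b 0 = 1
  pos : ∀ n, 0 < b n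
  antitone : Antitone b
  logConvex : Monotone fun n => b (n + 1) / b n

/-- The power series `A` with `1 / ∑ bₙ Xⁿ = 1 - A`. -/
def recipDefect (b : ℕ → ℝ) : ℝ⟦X⟧ := 1 - (mk b)⁻¹

/-- The quotient of `∑ hₙ bₙ Xⁿ` by `∑ bₙ Xⁿ`. -/
def quotSeries (b h : ℕ → ℝ) : ℝ⟦X⟧ := mk (fun n => h n * b n) * (mk b)⁻¹

variable {b h : ℕ → ℝ} {L : ℝ}

lemma inv_mk_eq_one_sub_recipDefect (b : ℕ → ℝ) : (mk b)⁻¹ = 1 - recipDefect b :=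
  (sub_sub_cancel _ _).symm

lemma mk_mul_inv_mk (hb : b 0 = 1) : mk b * (mk b)⁻¹ = 1 :=
  PowerSeries.mul_inv_cancel _ (by simp [hb])

lemma coeff_zero_recipDefect (hb : b 0 = 1) : coeff 0 (recipDefect b) = 0 := by
  simp [recipDefect, hb]

lemma coeff_zero_quotSeries (hh : h 0 = 0) : coeff 0 (quotSeries b h) = 0 := by
  simp [quotSeries, hh]

lemma sum_antidiagonal_recipDefect (hb : b 0 = 1) (n : ℕ) :
    ∑ p ∈ antidiagonal (n + 1), coeff p.1 (recipDefect b) * b p.2 = b (n + 1) := by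
  have hinv : recipDefect b * mk b = mk b - 1 := by
    rw [recipDefect, sub_mul, one_mul, mul_comm, mk_mul_inv_mk hb]
  simpa [coeff_mul, coeff_one] using congrArg (coeff (n + 1)) hinv

lemma sum_range_recipDefect (hb : b 0 = 1) (n : ℕ) :
    ∑ k ∈ range (n + 1), coeff (k + 1) (recipDefect b) * b (n - k) = b (n + 1) := by
  rw [← sum_antidiagonal_recipDefect hb n,
    Finset.Nat.sum_antidiagonal_eq_sum_range_succ fun i j => coeff i (recipDefect b) * b j,
    Finset.sum_range_succ' _ (n + 1), coeff_zero_recipDefect hb, zero_mul, add_zero]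
  simp only [Nat.add_sub_add_right]

lemma quotSeries_eq_C_sub (hb : b 0 = 1) (h : ℕ → ℝ) (L : ℝ) :
    quotSeries b h = PowerSeries.C L - mk (fun n => (L - h n) * b n) * (mk b)⁻¹ := by
  have hsplit : mk (fun n => (L - h n) * b n) = PowerSeries.C L * mk b - mk fun n => h n * b n := by
    ext n
    simp [sub_mul]
  rw [quotSeries, hsplit]
  linear_combination PowerSeries.C L * mk_mul_inv_mk hb

namespace IsKaluza

lemma le_one (hb : IsKaluza b) (n : ℕ) : b n ≤ 1 := hb.zero ▸ hb.antitone n.zero_le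

-- Raising the index multiplies each `b (n - k)` by at most `b (n + 2) / b (n + 1)`, so the
-- recursion for `a (n + 2)` leaves a nonnegative remainder.
theorem coeff_recipDefect_nonneg (hb : IsKaluza b) (n : ℕ) : 0 ≤ coeff n (recipDefect b) := by
  induction n using Nat.strong_induction_on with
  | _ n ih =>
    rcases n with _ | _ | n
    · rw [coeff_zero_recipDefect hb.zero]
    · have hone := sum_range_recipDefect hb.zero 0
      rw [Finset.sum_range_one, hb.zero, mul_one] at hone
      exact hone ▸ (hb.pos 1).le
    have hprev := sum_range_recipDefect hb.zero n
    have hnext := sum_range_recipDefect hb.zero (n + 1)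
    rw [Finset.sum_range_succ, Nat.sub_self, hb.zero, mul_one] at hnext
    have hle : ∑ k ∈ range (n + 1), coeff (k + 1) (recipDefect b) * b (n + 1 - k) ≤
        ∑ k ∈ range (n + 1),
          coeff (k + 1) (recipDefect b) * b (n - k) * (b (n + 2) / b (n + 1)) := by
      refine Finset.sum_le_sum fun k hk => ?_
      have hkn : k ≤ n := Finset.mem_range_succ_iff.1 hk
      have hratio := hb.logConvex (show n - k ≤ n + 1 by omega)
      rw [div_le_iff₀ (hb.pos _)] at hratio
      rw [mul_assoc, Nat.sub_add_comm hkn, mul_comm (b (n - k))]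
      exact mul_le_mul_of_nonneg_left hratio (ih _ (by omega))
    rw [← Finset.sum_mul, hprev, mul_div_cancel₀ _ (hb.pos _).ne'] at hle
    linarith

lemma coeff_recipDefect_le (hb : IsKaluza b) (n : ℕ) : coeff n (recipDefect b) ≤ b n := by
  rcases n with _ | n
  · exact (coeff_zero_recipDefect hb.zero).trans_le (hb.pos 0).le
  have hlast := Finset.single_le_sum
    (f := fun k => coeff (k + 1) (recipDefect b) * b (n - k)) (s := range (n + 1))
    (fun k _ => mul_nonneg (hb.coeff_recipDefect_nonneg _) (hb.pos _).le)
    (Finset.self_mem_range_succ n)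
  simpa [hb.zero, sum_range_recipDefect hb.zero n] using hlast

lemma sum_coeff_recipDefect_le_one (hb : IsKaluza b) (n : ℕ) :
    ∑ k ∈ range n, coeff k (recipDefect b) ≤ 1 := by
  rcases n with _ | n
  · simp
  rw [Finset.sum_range_succ', coeff_zero_recipDefect hb.zero, add_zero]
  rcases n with _ | n
  · simp
  refine le_of_mul_le_mul_right ?_ (hb.pos (n + 1))
  rw [one_mul, Finset.sum_mul]
  refine (Finset.sum_le_sum fun k _ => ?_).trans (sum_range_recipDefect hb.zero n).le
  exact mul_le_mul_of_nonneg_left (hb.antitone (by omega)) (hb.coeff_recipDefect_nonneg _)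

lemma summable_coeff_recipDefect (hb : IsKaluza b) : Summable fun n => coeff n (recipDefect b) :=
  summable_of_sum_range_le hb.coeff_recipDefect_nonneg hb.sum_coeff_recipDefect_le_one

lemma coeff_quotSeries_nonneg (hb : IsKaluza b) (hh0 : 0 ≤ h 0) (hh : Monotone h) (n : ℕ) :
    0 ≤ coeff n (quotSeries b h) := by
  rcases n with _ | n
  · simpa [quotSeries, hb.zero] using hh0
  have hcoeff : coeff (n + 1) (quotSeries b h) =
      ∑ p ∈ antidiagonal (n + 1), (h (n + 1) - h p.2) * (coeff p.1 (recipDefect b) * b p.2) := by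
    simp only [sub_mul, Finset.sum_sub_distrib]
    rw [← Finset.mul_sum, sum_antidiagonal_recipDefect hb.zero, quotSeries,
      inv_mk_eq_one_sub_recipDefect, mul_sub, mul_one, mul_comm, map_sub, coeff_mk, coeff_mul]
    simp only [coeff_mk, mul_left_comm]
  rw [hcoeff]
  refine Finset.sum_nonneg fun p hp => mul_nonneg (sub_nonneg.2 (hh ?_))
    (mul_nonneg (hb.coeff_recipDefect_nonneg _) (hb.pos _).le)
  have := Finset.HasAntidiagonal.mem_antidiagonal.1 hp
  omega

end IsKaluza

end Kaluza

section Analytic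

/-- `f` is the sum of the power series `p` on the disk of radius `R` about `0`. -/
def IsSumOn (p : ℂ⟦X⟧) (f : ℂ → ℂ) (R : ℝ) : Prop :=
  ∀ z : ℂ, ‖z‖ < R → HasSum (fun n => coeff n p * z ^ n) (f z)

/-- A real power series regarded as a complex one. -/
abbrev complexify (p : ℝ⟦X⟧) : ℂ⟦X⟧ := PowerSeries.map Complex.ofRealHom p

lemma complexify_derivative (p : ℝ⟦X⟧) : complexify (d⁄dX ℝ p) = d⁄dX ℂ (complexify p) := by
  ext n
  simp [coeff_derivative]

lemma complexify_inv {p : ℝ⟦X⟧} (hp : constantCoeff p ≠ 0) :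
    complexify p⁻¹ = (complexify p)⁻¹ := by
  rw [PowerSeries.eq_inv_iff_mul_eq_one (by
      rw [← coeff_zero_eq_constantCoeff_apply, coeff_map]; simpa using hp), ← map_mul,
    PowerSeries.inv_mul_cancel _ hp, map_one]

lemma eq_of_derivative_eq_mul {k : Type*} [Field k] [CharZero k] {f f' g : k⟦X⟧}
    (hf : d⁄dX k f = g * f) (hf' : d⁄dX k f' = g * f')
    (h0 : constantCoeff f = constantCoeff f') (hne : constantCoeff f ≠ 0) : f = f' := by
  have hcancel := PowerSeries.mul_inv_cancel f hne
  have hone : f' * f⁻¹ = 1 := by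
    refine derivative.ext ?_ (by simp [← h0, hne])
    rw [Derivation.leibniz, derivative_inv', hf, hf', derivative_one, smul_eq_mul, smul_eq_mul]
    linear_combination -f⁻¹ * f' * g * hcancel
  linear_combination f' * hcancel - f * hone

namespace IsSumOn

variable {p p' : ℂ⟦X⟧} {f g : ℂ → ℂ} {R : ℝ}

lemma congr (h : IsSumOn p f R) (hfg : ∀ z, ‖z‖ < R → f z = g z) : IsSumOn p g R :=
  fun z hz => hfg z hz ▸ h z hz

lemma hasFPowerSeriesOnBall (h : IsSumOn p f R) (hR : 0 < R) :
    HasFPowerSeriesOnBall f (FormalMultilinearSeries.ofScalars ℂ fun n => coeff n p) 0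
      (ENNReal.ofReal R) where
  r_le := by
    refine ENNReal.le_of_forall_nnreal_lt fun r hr => ?_
    have hr' : (r : ℝ) < R := by
      rwa [ENNReal.ofReal, ENNReal.coe_lt_coe, Real.lt_toNNReal_iff_coe_lt] at hr
    refine FormalMultilinearSeries.le_radius_of_tendsto _ (l := 0) ?_
    refine (h (r : ℂ) (by simpa using hr')).summable.norm.tendsto_atTop_zero.congr fun n => ?_
    simp
  r_pos := by simpa using hR
  hasSum := by
    intro y hy
    rw [Metric.eball_ofReal, Metric.mem_ball, dist_zero_right] at hy
    rw [zero_add]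
    refine (h y hy).congr_fun fun n => ?_
    simp [mul_comm]

lemma iteratedDeriv_eq (h : IsSumOn p f R) (hR : 0 < R) (n : ℕ) :
    iteratedDeriv n f 0 = n.factorial * coeff n p := by
  rw [iteratedDeriv_eq_iteratedFDeriv, ← (h.hasFPowerSeriesOnBall hR).factorial_smul (1 : ℂ) n]
  simp

lemma taylorCoeff_eq (h : IsSumOn p f R) (hR : 0 < R) (n : ℕ) : taylorCoeff f n = coeff n p := by
  rw [taylorCoeff, h.iteratedDeriv_eq hR]
  exact mul_div_cancel_left₀ _ (Nat.cast_ne_zero.2 n.factorial_ne_zero)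

lemma unique (h : IsSumOn p f R) (h' : IsSumOn p' f R) (hR : 0 < R) : p = p' := by
  ext n
  rw [← h.taylorCoeff_eq hR, h'.taylorCoeff_eq hR]

lemma constantCoeff_eq (h : IsSumOn p f R) (hR : 0 < R) : constantCoeff p = f 0 := by
  simpa [taylorCoeff] using (h.taylorCoeff_eq hR 0).symm

lemma differentiableOn (h : IsSumOn p f R) (hR : 0 < R) :
    DifferentiableOn ℂ f (Metric.ball 0 R) :=
  Metric.eball_ofReal (x := (0 : ℂ)) ▸ (h.hasFPowerSeriesOnBall hR).differentiableOn

lemma of_differentiableOn (h : DifferentiableOn ℂ f (Metric.ball 0 R)) :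
    IsSumOn (mk (taylorCoeff f)) f R := by
  intro z hz
  refine (Complex.hasSum_taylorSeries_on_ball h (z := z) (by simpa using hz)).congr_fun fun n => ?_
  simp only [coeff_mk, taylorCoeff, sub_zero, smul_eq_mul]
  ring

lemma deriv (h : IsSumOn p f R) (hR : 0 < R) : IsSumOn (d⁄dX ℂ p) (deriv f) R := by
  convert of_differentiableOn ((h.differentiableOn hR).deriv Metric.isOpen_ball) using 1
  ext n
  have := Nat.cast_ne_zero (R := ℂ).2 n.factorial_ne_zero
  rw [coeff_mk, taylorCoeff, ← iteratedDeriv_succ', h.iteratedDeriv_eq hR, Nat.factorial_succ,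
    coeff_derivative]
  push_cast
  field_simp

lemma mul (h : IsSumOn p f R) (h' : IsSumOn p' g R) : IsSumOn (p * p') (fun z => f z * g z) R := by
  intro z hz
  have hp := (h z hz).summable.norm
  have hp' := (h' z hz).summable.norm
  have hsum := (summable_norm_sum_mul_antidiagonal_of_summable_norm hp hp').of_norm.hasSum
  rw [← tsum_mul_tsum_eq_tsum_sum_antidiagonal_of_summable_norm hp hp', (h z hz).tsum_eq,
    (h' z hz).tsum_eq] at hsum
  refine hsum.congr_fun fun n => ?_
  rw [coeff_mul, Finset.sum_mul]
  refine Finset.sum_congr rfl fun i hi => ?_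
  rw [← Finset.HasAntidiagonal.mem_antidiagonal.1 hi, pow_add]
  ring

lemma X : IsSumOn (X : ℂ⟦X⟧) id R := by
  intro z _
  convert hasSum_single (f := fun n => coeff n (PowerSeries.X : ℂ⟦X⟧) * z ^ n) 1 ?_ using 1
  · simp
  · intro n hn
    simp [coeff_X, hn]

lemma one : IsSumOn 1 (fun _ => 1) R := by
  intro z _
  convert hasSum_single (f := fun n => coeff n (1 : ℂ⟦X⟧) * z ^ n) 0 ?_ using 1
  · simp
  · intro n hn
    simp [coeff_one, hn]

lemma rescale (h : IsSumOn p f R) {c : ℂ} (hc : c ≠ 0) :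
    IsSumOn (PowerSeries.rescale c p) (fun z => f (c * z)) (R / ‖c‖) := by
  intro z hz
  rw [lt_div_iff₀ (norm_pos_iff.2 hc), mul_comm, ← norm_mul] at hz
  refine (h _ hz).congr_fun fun n => ?_
  rw [coeff_rescale, mul_pow]
  ring

lemma inv (h : IsSumOn p f R) (h' : IsSumOn p⁻¹ g R) (hp : constantCoeff p ≠ 0) :
    IsSumOn p⁻¹ (fun z => (f z)⁻¹) R := by
  refine h'.congr fun z hz => ?_
  refine eq_inv_of_mul_eq_one_right ((h.mul h' z hz).unique ?_)
  rw [PowerSeries.mul_inv_cancel _ hp]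
  exact one z hz

lemma exp {e : ℂ⟦X⟧} (h : IsSumOn p f R) (hR : 0 < R) (he0 : constantCoeff e = Complex.exp (f 0))
    (he : d⁄dX ℂ e = d⁄dX ℂ p * e) : IsSumOn e (fun z => Complex.exp (f z)) R := by
  have hsum := of_differentiableOn (h.differentiableOn hR).cexp
  convert hsum using 1
  have hderiv : d⁄dX ℂ (mk (taylorCoeff fun z => Complex.exp (f z))) =
      d⁄dX ℂ p * mk (taylorCoeff fun z => Complex.exp (f z)) := by
    refine (hsum.deriv hR).unique (((h.deriv hR).mul hsum).congr fun z hz => ?_) hR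
    have hf : DifferentiableAt ℂ f z := (h.differentiableOn hR).differentiableAt
      (Metric.isOpen_ball.mem_nhds (by simpa using hz))
    rw [hf.hasDerivAt.cexp.deriv, mul_comm]
  exact eq_of_derivative_eq_mul he hderiv (he0.trans (hsum.constantCoeff_eq hR).symm)
    (he0.trans_ne (Complex.exp_ne_zero _))

end IsSumOn

lemma isSumOn_of_bounded {p : ℂ⟦X⟧} {M : ℝ} (h : ∀ n, ‖coeff n p‖ ≤ M) :
    IsSumOn p (fun z => ∑' n, coeff n p * z ^ n) 1 := by
  intro z hz
  refine (Summable.of_norm_bounded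
    ((summable_geometric_of_lt_one (norm_nonneg z) hz).mul_left M) fun n => ?_).hasSum
  rw [norm_mul, norm_pow]
  exact mul_le_mul_of_nonneg_right (h n) (by positivity)

section Boundary

variable {p q : ℝ⟦X⟧} {f g : ℂ → ℂ} {R : ℝ}

lemma IsSumOn.hasSum_re (hf : IsSumOn (complexify p) f R) {x : ℝ} (hx0 : 0 ≤ x) (hxR : x < R) :
    HasSum (fun n => coeff n p * x ^ n) (f x).re := by
  have hre := Complex.hasSum_re (hf x (by simpa [abs_of_nonneg hx0] using hxR))
  simpa only [coeff_map, Complex.ofRealHom_eq_coe, ← Complex.ofReal_pow, ← Complex.ofReal_mul,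
    Complex.ofReal_re] using hre

lemma IsSumOn.norm_le_mul_norm {L : ℝ} (hL : 0 ≤ L) (hpq : ∀ n, |coeff n q| ≤ L * coeff n p)
    (hf : IsSumOn (complexify p) f R) (hg : IsSumOn (complexify q) g R) {x : ℝ} (hx0 : 0 ≤ x)
    (hxR : x < R) : ‖g x‖ ≤ L * ‖f x‖ := by
  rw [← (hg x (by simpa [abs_of_nonneg hx0] using hxR)).tsum_eq]
  refine (tsum_of_norm_bounded ((hf.hasSum_re hx0 hxR).mul_left L) fun n => ?_).trans
    (mul_le_mul_of_nonneg_left (Complex.re_le_norm _) hL)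
  rw [norm_mul, norm_pow, coeff_map, Complex.ofRealHom_eq_coe, Complex.norm_real,
    Complex.norm_real, Real.norm_of_nonneg hx0, ← mul_assoc]
  exact mul_le_mul_of_nonneg_right (hpq n) (by positivity)

lemma IsSumOn.sum_coeff_mul_pow_le (hR : 0 < R) (hp : ∀ n, 0 ≤ coeff n p)
    (hf : IsSumOn (complexify p) f R) {M : ℝ} (hM : ∀ᶠ x : ℝ in 𝓝[<] R, ‖f x‖ ≤ M) (n : ℕ) :
    ∑ i ∈ range n, coeff i p * R ^ i ≤ M := by
  have hcont : Continuous fun x : ℝ => ∑ i ∈ range n, coeff i p * x ^ i := by fun_prop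
  refine le_of_tendsto ((hcont.tendsto R).mono_left (nhdsWithin_le_nhds (s := Set.Iio R))) ?_
  filter_upwards [hM, Ioo_mem_nhdsLT hR] with x hxM hx
  exact (sum_le_hasSum _ (fun i _ => mul_nonneg (hp i) (pow_nonneg hx.1.le _))
    (hf.hasSum_re hx.1.le hx.2)).trans ((Complex.re_le_norm _).trans hxM)

lemma tendsto_ofReal_nhdsWithin_ball (hR : 0 < R) :
    Tendsto (fun x : ℝ => (x : ℂ)) (𝓝[<] R) (𝓝[Metric.ball 0 R] (R : ℂ)) := by
  refine tendsto_nhdsWithin_iff.2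
    ⟨(Complex.continuous_ofReal.tendsto R).mono_left nhdsWithin_le_nhds, ?_⟩
  filter_upwards [Ioo_mem_nhdsLT hR] with x hx
  simpa [abs_of_pos hx.1] using hx.2

lemma eventuallyEq_deriv_nhdsWithin {s : Set ℂ} (hs : IsOpen s) {z : ℂ} (h : f =ᶠ[𝓝[s] z] g) :
    deriv f =ᶠ[𝓝[s] z] deriv g := by
  rw [EventuallyEq, eventually_nhdsWithin_iff] at h ⊢
  filter_upwards [h.eventually_nhds] with y hy hys
  refine EventuallyEq.deriv_eq ?_
  filter_upwards [hy, hs.mem_nhds hys] with x hx hxs using hx hxs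

-- Pringsheim's argument, applied to `p` and to its iterated Euler derivatives.
lemma summable_pow_mul_coeff_of_analyticAt (hR : 0 < R) (hp : ∀ n, 0 ≤ coeff n p)
    (hf : IsSumOn (complexify p) f R) (hg : AnalyticAt ℂ g R)
    (hfg : f =ᶠ[𝓝[Metric.ball 0 R] (R : ℂ)] g) (j : ℕ) :
    Summable fun n : ℕ => (n : ℝ) ^ j * (coeff n p * R ^ n) := by
  induction j generalizing p f g with
  | zero =>
    simp only [pow_zero, one_mul]
    obtain ⟨M, hM⟩ := hg.continuousAt.norm.isBoundedUnder_le
    have hbound : ∀ᶠ z in 𝓝[Metric.ball 0 R] (R : ℂ), ‖f z‖ ≤ M := by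
      filter_upwards [hfg, (eventually_map.1 hM).filter_mono nhdsWithin_le_nhds] with z hz hzM
      exact hz ▸ hzM
    exact summable_of_sum_range_le (fun n => mul_nonneg (hp n) (by positivity))
      (hf.sum_coeff_mul_pow_le hR hp ((tendsto_ofReal_nhdsWithin_ball hR).eventually hbound))
  | succ j ih =>
    have hderiv := (eventuallyEq_deriv_nhdsWithin Metric.isOpen_ball hfg).fun_mul
      (EventuallyEq.refl _ id)
    have hsum := ih (p := d⁄dX ℝ p * PowerSeries.X) (fun n => by
        rw [mul_comm, coeff_X_mul_derivative]
        exact mul_nonneg n.cast_nonneg (hp n))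
      (by
        rw [complexify, map_mul, map_X, ← complexify, complexify_derivative]
        exact (hf.deriv hR).mul IsSumOn.X) (hg.deriv.fun_mul analyticAt_id) hderiv
    refine hsum.congr fun n => ?_
    rw [mul_comm (d⁄dX ℝ p), coeff_X_mul_derivative]
    ring

lemma norm_coeff_mul_pow_le (hp : ∀ n, 0 ≤ coeff n p) {z : ℂ} (hz : ‖z‖ ≤ R) (n : ℕ) :
    ‖coeff n (complexify p) * z ^ n‖ ≤ coeff n p * R ^ n := by
  rw [norm_mul, norm_pow, coeff_map, Complex.ofRealHom_eq_coe, Complex.norm_real,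
    Real.norm_of_nonneg (hp n)]
  gcongr
  exact hp n

lemma IsSumOn.tendsto_boundary (hp : ∀ n, 0 ≤ coeff n p) (hf : IsSumOn (complexify p) f R)
    (hs : Summable fun n => coeff n p * R ^ n) {z : ℂ} (hz : ‖z‖ ≤ R) :
    Tendsto f (𝓝[Metric.ball 0 R] z) (𝓝 (∑' n, coeff n (complexify p) * z ^ n)) := by
  have hcont : ContinuousOn (fun y : ℂ => ∑' n, coeff n (complexify p) * y ^ n)
      (Metric.closedBall 0 R) :=
    continuousOn_tsum (fun n => by fun_prop) hs fun n y hy =>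
      norm_coeff_mul_pow_le hp (by simpa using hy) n
  refine ((hcont z (by simpa using hz)).mono_left
    (nhdsWithin_mono _ Metric.ball_subset_closedBall)).congr' ?_
  filter_upwards [self_mem_nhdsWithin] with y hy
  exact (hf y (by simpa using hy)).tsum_eq

end Boundary

end Analytic

section NonnegativeCoefficients

variable {p : ℝ⟦X⟧} {f : ℂ → ℂ} {v : ℕ → ℝ} {R M c : ℝ}

lemma summable_coeff_mul_pow (hR : 0 ≤ R) (hp : ∀ n, 0 ≤ coeff n p)
    (hM : ∀ n, ∑ i ∈ range n, coeff i p * R ^ i ≤ M) : Summable fun n => coeff n p * R ^ n :=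
  summable_of_sum_range_le (fun n => mul_nonneg (hp n) (pow_nonneg hR n)) hM

lemma summable_coeff_complexify_mul_pow (hR : 0 ≤ R) (hp : ∀ n, 0 ≤ coeff n p)
    (hM : ∀ n, ∑ i ∈ range n, coeff i p * R ^ i ≤ M) {z : ℂ} (hz : ‖z‖ ≤ R) :
    Summable fun n => coeff n (complexify p) * z ^ n :=
  .of_norm_bounded (summable_coeff_mul_pow hR hp hM) (norm_coeff_mul_pow_le hp hz)

lemma norm_tsum_coeff_complexify_mul_pow_le (hR : 0 ≤ R) (hp : ∀ n, 0 ≤ coeff n p)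
    (hM : ∀ n, ∑ i ∈ range n, coeff i p * R ^ i ≤ M) {z : ℂ} (hz : ‖z‖ ≤ R) :
    ‖∑' n, coeff n (complexify p) * z ^ n‖ ≤ M :=
  (tsum_of_norm_bounded (summable_coeff_mul_pow hR hp hM).hasSum
    (norm_coeff_mul_pow_le hp hz)).trans
      (Real.tsum_le_of_sum_range_le (fun n => mul_nonneg (hp n) (pow_nonneg hR n)) hM)

lemma IsSumOn.not_exists_analyticAt (hR : 0 < R) (hp : ∀ n, 0 ≤ coeff n p)
    (hf : IsSumOn (complexify p) f R) {j : ℕ} (hv : v =O[atTop] fun n : ℕ => (n : ℝ) ^ j)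
    (hc : c ≠ 0) (h : Tendsto (fun n => coeff n p * R ^ n * v n) atTop (𝓝 c)) :
    ¬ ∃ g : ℂ → ℂ, AnalyticAt ℂ g R ∧ f =ᶠ[𝓝[Metric.ball 0 R] (R : ℂ)] g := by
  rintro ⟨g, hg, hfg⟩
  have hzero := (summable_pow_mul_coeff_of_analyticAt hR hp hf hg hfg j).tendsto_atTop_zero
  have hbig := (isBigO_refl (fun n => coeff n p * R ^ n) atTop).mul hv
  simp only [mul_comm _ ((_ : ℝ) ^ j)] at hbig
  exact hc (tendsto_nhds_unique h (hbig.trans_tendsto hzero))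

lemma IsSumOn.radius_eq {p : ℂ⟦X⟧} (hf : IsSumOn p f R) (hR : 0 < R) {z : ℂ} (hz : ‖z‖ = R)
    (hsing : ¬ ∃ g : ℂ → ℂ, AnalyticAt ℂ g z ∧ f =ᶠ[𝓝[Metric.ball 0 R] z] g) :
    (FormalMultilinearSeries.ofScalars ℂ fun n => coeff n p).radius = ENNReal.ofReal R := by
  have hball := hf.hasFPowerSeriesOnBall hR
  refine le_antisymm (le_of_not_gt fun hlt => hsing ?_) hball.r_le
  have hlarge := FormalMultilinearSeries.hasFPowerSeriesOnBall _ (hball.r_pos.trans hlt)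
  refine ⟨_, hlarge.analyticAt_of_mem ?_, ?_⟩
  · rwa [Metric.mem_eball, edist_zero_right, ← ofReal_norm, hz]
  · filter_upwards [self_mem_nhdsWithin] with y hy
    rw [← Metric.eball_ofReal] at hy
    simpa only [zero_add] using
      (hball.hasSum hy).unique (hlarge.hasSum (Metric.eball_subset_eball hlt.le hy))

lemma isEquivalent_coeff_complexify {K : ℝ} (hK : K ≠ 0) (hc : c ≠ 0)
    (h : Tendsto (fun n => coeff n p * (1 / K) ^ n * v n) atTop (𝓝 c)) :
    (fun n => coeff n (complexify p)) ~[atTop] fun n => ((c * (K ^ n / v n) : ℝ) : ℂ) := by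
  have hreal : (fun n => coeff n p) ~[atTop] fun n => c * (K ^ n / v n) := by
    have hv : ∀ᶠ n in atTop, c * (K ^ n / v n) ≠ 0 := by
      filter_upwards [h.eventually_ne hc] with n hn
      exact mul_ne_zero hc (div_ne_zero (pow_ne_zero n hK) (right_ne_zero_of_mul hn))
    rw [isEquivalent_iff_tendsto_one hv, ← div_self hc]
    refine (h.div_const c).congr fun n => ?_
    rw [Pi.div_apply, one_div, inv_pow, div_mul_eq_div_div_swap, div_div_eq_mul_div]
    ring
  have hcomplex : (fun n => ((coeff n p - c * (K ^ n / v n) : ℝ) : ℂ)) =o[atTop]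
      fun n => ((c * (K ^ n / v n) : ℝ) : ℂ) :=
    Complex.isLittleO_ofReal_left.2 (Complex.isLittleO_ofReal_right.2 hreal.isLittleO)
  refine hcomplex.congr_left fun n => ?_
  rw [Pi.sub_apply, Complex.ofReal_sub, coeff_map, Complex.ofRealHom_eq_coe]

end NonnegativeCoefficients

section Exponential

/-- The composite `exp (g)`, for a power series `g` without constant term. -/
def expSeries (g : ℝ⟦X⟧) : ℝ⟦X⟧ := (PowerSeries.exp ℝ).subst g

variable {g : ℝ⟦X⟧} {w : ℕ → ℝ} {γ : ℝ}

lemma constantCoeff_expSeries (hg : constantCoeff g = 0) : constantCoeff (expSeries g) = 1 := by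
  have hsub := constantCoeff_subst_eq_zero hg (PowerSeries.exp ℝ - 1) (by simp)
  have hg' : HasSubst g := .of_constantCoeff_zero' hg
  rw [← coe_substAlgHom hg', map_sub, map_one, coe_substAlgHom hg'] at hsub
  rw [← expSeries, map_sub, map_one, sub_eq_zero] at hsub
  exact hsub

lemma derivative_expSeries (hg : constantCoeff g = 0) :
    d⁄dX ℝ (expSeries g) = d⁄dX ℝ g * expSeries g := by
  rw [expSeries, derivative_subst (.of_constantCoeff_zero' hg), derivative_exp, mul_comm]

lemma coeff_nonneg_of_derivative_eq_mul {f : ℝ⟦X⟧} (h : d⁄dX ℝ f = d⁄dX ℝ g * f)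
    (hf : 0 ≤ constantCoeff f) (hg : ∀ n, 0 ≤ coeff n g) (n : ℕ) : 0 ≤ coeff n f := by
  induction n using Nat.strong_induction_on with
  | _ n ih =>
    rcases n with _ | n
    · simpa using hf
    have hcoeff := congrArg (coeff n) h
    rw [coeff_derivative, coeff_mul] at hcoeff
    refine nonneg_of_mul_nonneg_left (hcoeff ▸ Finset.sum_nonneg fun p hp => ?_)
      (by positivity : (0 : ℝ) < n + 1)
    rw [coeff_derivative]
    have := Finset.HasAntidiagonal.mem_antidiagonal.1 hp
    exact mul_nonneg (mul_nonneg (hg _) (by positivity)) (ih _ (by omega))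

lemma isSumOn_expSeries {f : ℂ → ℂ} {R : ℝ} (hR : 0 < R) (hg : constantCoeff g = 0)
    (hf : IsSumOn (complexify g) f R) :
    IsSumOn (complexify (expSeries g)) (fun z => Complex.exp (f z)) R := by
  have hf0 : f 0 = 0 := by
    rw [← hf.constantCoeff_eq hR, ← coeff_zero_eq_constantCoeff_apply, coeff_map,
      coeff_zero_eq_constantCoeff_apply, hg, map_zero]
  refine hf.exp hR ?_ ?_
  · rw [← coeff_zero_eq_constantCoeff_apply, coeff_map, coeff_zero_eq_constantCoeff_apply,
      constantCoeff_expSeries hg, map_one, hf0, Complex.exp_zero]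
  · rw [← complexify_derivative, ← complexify_derivative, derivative_expSeries hg, complexify,
      map_mul]

lemma tendsto_coeff_expSeries_div (hw : IsTempered w) (hws : Summable w)
    (hw0 : Tendsto (fun n : ℕ => ((n : ℝ) + 1) * w n) atTop (𝓝 0)) (hg0 : constantCoeff g = 0)
    (hg : Tendsto (fun n => coeff n g / w n) atTop (𝓝 γ))
    (hsum : Summable fun n => coeff n (expSeries g)) :
    Tendsto (fun n => coeff n (expSeries g) / w n) atTop
      (𝓝 (γ * ∑' n, coeff n (expSeries g))) := by
  have hXg := (tendsto_coeff_X_mul_derivative_div_iff hw.pos).2 hg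
  have hO := isBigO_coeff_of_derivative_eq_mul hw hw0
    (isBigO_of_tendsto_div hw.succ_mul.pos hXg) hsum (derivative_expSeries hg0)
  rw [← tendsto_coeff_X_mul_derivative_div_iff hw.pos, derivative_expSeries hg0,
    ← mul_assoc, mul_comm]
  exact tendsto_coeff_mul_div_of_isBigO hw hws hw.succ_mul hw0 (isBigO_refl _ _) hO hXg

end Exponential

section SummableWeight

variable {b h w : ℕ → ℝ} {L α κ : ℝ}

lemma tendsto_coeff_inv_mk_div (h : Tendsto (fun n => coeff n (recipDefect b) / w n) atTop (𝓝 α)) :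
    Tendsto (fun n => coeff n (mk b)⁻¹ / w n) atTop (𝓝 (-α)) := by
  refine h.neg.congr' ?_
  filter_upwards [eventually_gt_atTop 0] with n hn
  rw [inv_mk_eq_one_sub_recipDefect, map_sub, coeff_one, if_neg hn.ne', zero_sub, neg_div]

lemma tendsto_coeff_quotSeries_div (hb : b 0 = 1) (hw : IsTempered w) (hws : Summable w)
    (ha : Tendsto (fun n => coeff n (recipDefect b) / w n) atTop (𝓝 α))
    (hd : Tendsto (fun n => (L - h n) * b n / w n) atTop (𝓝 0)) :
    Tendsto (fun n => coeff n (quotSeries b h) / w n) atTop (𝓝 (α * ∑' n, (L - h n) * b n)) := by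
  have hmul := (tendsto_coeff_mul_div (f := mk fun n => (L - h n) * b n) hw hws
    (by simpa only [coeff_mk] using hd) (tendsto_coeff_inv_mk_div ha)).neg
  simp only [coeff_mk, zero_mul, add_zero, neg_mul, neg_neg] at hmul
  refine hmul.congr' ?_
  filter_upwards [eventually_gt_atTop 0] with n hn
  rw [quotSeries_eq_C_sub hb h L, map_sub, coeff_C, if_neg hn.ne', zero_sub, neg_div]

lemma tsum_coeff_mul {f g : ℝ⟦X⟧} (hf : Summable fun n => |coeff n f|)
    (hg : Summable fun n => |coeff n g|) :
    ∑' n, coeff n (f * g) = (∑' n, coeff n f) * ∑' n, coeff n g := by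
  rw [tsum_mul_tsum_eq_tsum_sum_antidiagonal_of_summable_norm (f := fun n => coeff n f)
    (g := fun n => coeff n g) hf hg]
  exact tsum_congr fun n => coeff_mul n f g

lemma X_mul_derivative_recipDefect (b : ℕ → ℝ) :
    X * d⁄dX ℝ (recipDefect b) = (mk b)⁻¹ * ((mk b)⁻¹ * (X * d⁄dX ℝ (mk b))) := by
  rw [recipDefect, map_sub, Derivation.map_one_eq_zero, zero_sub, derivative_inv']
  ring

lemma IsKaluza.isBigO_coeff_recipDefect (hb : IsKaluza b) (hbw : b =O[atTop] w) :
    (fun n => coeff n (recipDefect b)) =O[atTop] w := by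
  refine (IsBigO.of_bound 1 (Eventually.of_forall fun n => ?_)).trans hbw
  rw [one_mul, Real.norm_of_nonneg (hb.coeff_recipDefect_nonneg n),
    Real.norm_of_nonneg (hb.pos n).le]
  exact hb.coeff_recipDefect_le n

lemma isBigO_coeff_inv_mk (h : (fun n => coeff n (recipDefect b)) =O[atTop] w) :
    (fun n => coeff n (mk b)⁻¹) =O[atTop] w := by
  refine h.neg_left.congr' ?_ .rfl
  filter_upwards [eventually_gt_atTop 0] with n hn
  rw [inv_mk_eq_one_sub_recipDefect, map_sub, coeff_one, if_neg hn.ne', zero_sub]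

theorem IsKaluza.exists_tendsto_coeff_recipDefect_div (hb : IsKaluza b) (hw : IsTempered w)
    (hws : Summable w) (hw0 : Tendsto (fun n : ℕ => ((n : ℝ) + 1) * w n) atTop (𝓝 0)) (hκ : 0 < κ)
    (hbw : Tendsto (fun n => b n / w n) atTop (𝓝 κ)) :
    ∃ α, 0 < α ∧ Tendsto (fun n => coeff n (recipDefect b) / w n) atTop (𝓝 α) := by
  have hbO := isBigO_of_tendsto_div hw.pos hbw
  have hrO := isBigO_coeff_inv_mk (hb.isBigO_coeff_recipDefect hbO)
  have hsum : (∑' n, b n) * ∑' n, coeff n (PowerSeries.mk b)⁻¹ = 1 := by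
    have hone : ∑' n, coeff n (1 : ℝ⟦X⟧) = 1 := by simp [coeff_one]
    rw [← hone, ← mk_mul_inv_mk hb.zero, tsum_coeff_mul
      (by simpa only [coeff_mk] using (summable_of_isBigO_nat hws hbO).abs)
      (summable_of_isBigO_nat hws hrO).abs]
    simp only [coeff_mk]
  refine ⟨κ * (∑' n, coeff n (PowerSeries.mk b)⁻¹) * ∑' n, coeff n (PowerSeries.mk b)⁻¹, ?_, ?_⟩
  · rw [mul_assoc]
    exact mul_pos hκ (mul_self_pos.2 (right_ne_zero_of_mul_eq_one hsum))
  rw [← tendsto_coeff_X_mul_derivative_div_iff hw.pos, X_mul_derivative_recipDefect]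
  have hXb : Tendsto
      (fun n : ℕ => coeff n (X * d⁄dX ℝ (PowerSeries.mk b)) / (((n : ℝ) + 1) * w n)) atTop (𝓝 κ) :=
    (tendsto_coeff_X_mul_derivative_div_iff hw.pos).2 (by simpa only [coeff_mk] using hbw)
  exact tendsto_coeff_mul_div_of_isBigO hw hws hw.succ_mul hw0 (isBigO_refl _ _) hrO
    (tendsto_coeff_mul_div_of_isBigO hw hws hw.succ_mul hw0 (isBigO_refl _ _) hrO hXb)

end SummableWeight

section Weights

/-- The weight `1 / log² n` of the borderline case, shifted so that it is defined everywhere. -/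
def logWeight (n : ℕ) : ℝ := 1 / Real.log ((n : ℝ) + 2) ^ 2

lemma summable_rpow_neg {s : ℝ} (hs : 1 < s) : Summable fun n : ℕ => ((n : ℝ) + 1) ^ (-s) := by
  simpa only [Nat.cast_add, Nat.cast_one] using
    (summable_nat_add_iff (f := fun n : ℕ => (n : ℝ) ^ (-s)) 1).2
      (Real.summable_nat_rpow.2 (neg_lt_neg hs))

lemma tendsto_succ_mul_rpow_neg {s : ℝ} (hs : 1 < s) :
    Tendsto (fun n : ℕ => ((n : ℝ) + 1) * ((n : ℝ) + 1) ^ (-s)) atTop (𝓝 0) := by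
  have hpow := (tendsto_rpow_neg_atTop (sub_pos.2 hs)).comp
    (tendsto_atTop_add_const_right _ (1 : ℝ) tendsto_natCast_atTop_atTop)
  refine hpow.congr fun n => ?_
  rw [Function.comp, ← Real.rpow_one_add' (by positivity) (by linarith), neg_sub, sub_eq_add_neg]

lemma log_add_two_pos (n : ℕ) : 0 < Real.log ((n : ℝ) + 2) :=
  Real.log_pos (by linarith [n.cast_nonneg (α := ℝ)])

lemma logWeight_pos (n : ℕ) : 0 < logWeight n := one_div_pos.2 (pow_pos (log_add_two_pos n) 2)

lemma tendsto_log_add_two : Tendsto (fun n : ℕ => Real.log ((n : ℝ) + 2)) atTop atTop :=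
  Real.tendsto_log_atTop.comp (tendsto_atTop_add_const_right _ 2 tendsto_natCast_atTop_atTop)

lemma tendsto_logWeight : Tendsto logWeight atTop (𝓝 0) :=
  ((tendsto_pow_atTop two_ne_zero).comp tendsto_log_add_two).inv_tendsto_atTop.congr fun _ =>
    (one_div _).symm

lemma tendsto_log_sq_div_succ :
    Tendsto (fun n : ℕ => Real.log ((n : ℝ) + 2) ^ 2 / ((n : ℝ) + 1)) atTop (𝓝 0) := by
  have hlog := ((isLittleO_log_rpow_rpow_atTop (s := 1) 2 one_pos).tendsto_div_nhds_zero.comp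
    (tendsto_atTop_add_const_right _ (2 : ℝ) tendsto_natCast_atTop_atTop)).mul
    (tendsto_one_div_add_atTop_nhds_zero_nat.const_add 1)
  rw [zero_mul] at hlog
  refine hlog.congr fun n => ?_
  rw [Function.comp, Real.rpow_one, Real.rpow_two]
  field_simp
  ring

lemma isBigO_succ_mul_rpow_neg_two_logWeight :
    (fun n : ℕ => ((n : ℝ) + 1) * ((n : ℝ) + 1) ^ (-2 : ℝ)) =O[atTop] logWeight := by
  refine isBigO_of_tendsto_div logWeight_pos (tendsto_log_sq_div_succ.congr fun n => ?_)
  rw [Real.rpow_neg (by positivity), Real.rpow_two, logWeight]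
  field_simp

lemma tendsto_log_add_two_div_log_add_three :
    Tendsto (fun n : ℕ => Real.log ((n : ℝ) + 2) / Real.log ((n : ℝ) + 3)) atTop (𝓝 1) := by
  have hdiff := Real.tendsto_log_nat_add_one_sub_log.comp (tendsto_add_atTop_nat 2)
  have hlog := tendsto_log_add_two.comp (tendsto_add_atTop_nat 1)
  have hquot := (hdiff.mul hlog.inv_tendsto_atTop).const_sub 1
  rw [mul_zero, sub_zero] at hquot
  refine hquot.congr fun n => ?_
  have hpos := log_add_two_pos (n + 1)
  simp only [Function.comp, Pi.inv_apply]
  push_cast at hpos ⊢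
  rw [show (n : ℝ) + 1 + 2 = n + 3 by ring] at hpos ⊢
  rw [show (n : ℝ) + 2 + 1 = n + 3 by ring]
  field_simp
  ring

lemma isTempered_logWeight : IsTempered logWeight where
  pos := logWeight_pos
  ratio := by
    have hsq := tendsto_log_add_two_div_log_add_three.pow 2
    rw [one_pow] at hsq
    refine hsq.congr fun n => ?_
    rw [logWeight, logWeight, div_div_div_eq, one_mul, mul_one, div_pow, Nat.cast_succ, add_assoc]
    norm_num
  doubling := by
    refine ⟨4, by norm_num, fun j n _ hn => ?_⟩
    have hn' : (n : ℝ) ≤ 2 * j := by exact_mod_cast hn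
    have hlog : Real.log ((n : ℝ) + 2) ≤ 2 * Real.log ((j : ℝ) + 2) := by
      rw [← Real.log_rpow (by positivity), Real.rpow_two]
      exact Real.log_le_log (by positivity) (by nlinarith [j.cast_nonneg (α := ℝ)])
    have hj := log_add_two_pos j
    have hn := log_add_two_pos n
    rw [logWeight, logWeight, mul_one_div, div_le_div_iff₀ (by positivity) (by positivity)]
    nlinarith

end Weights

section Tail

/-- The tails `1 - a₀ - ⋯ - aₙ` of the coefficients `aₙ` of `recipDefect b`. -/
def tail (b : ℕ → ℝ) (n : ℕ) : ℝ := 1 - ∑ k ∈ range (n + 1), coeff k (recipDefect b)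

/-- The series of the differences `n bₙ - (n - 1) bₙ₋₁`, which measure how far `bₙ` is from being
proportional to `1 / n`. -/
def eulerDiff (b : ℕ → ℝ) : ℝ⟦X⟧ := (1 - X) * (X * d⁄dX ℝ (mk b))

variable {b v : ℕ → ℝ} {β κ : ℝ}

lemma sum_range_coeff_one_sub_X_mul {R : Type*} [CommRing R] (f : R⟦X⟧) (n : ℕ) :
    ∑ k ∈ range (n + 1), coeff k ((1 - X) * f) = coeff n f := by
  simp only [sub_mul, one_mul, map_sub]
  rw [Finset.sum_sub_distrib, Finset.sum_range_succ, Finset.sum_range_succ' (fun k => coeff k _)]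
  simp [coeff_succ_X_mul]

lemma coeff_succ_eulerDiff (b : ℕ → ℝ) (n : ℕ) :
    coeff (n + 1) (eulerDiff b) = ((n : ℝ) + 1) * b (n + 1) - n * b n := by
  rw [eulerDiff, sub_mul, one_mul, map_sub, coeff_X_mul_derivative, coeff_succ_X_mul,
    coeff_X_mul_derivative, coeff_mk, coeff_mk, Nat.cast_succ]

lemma tsum_coeff_eulerDiff (h : ∀ n, 0 ≤ coeff n (eulerDiff b))
    (hb : Tendsto (fun n : ℕ => (n : ℝ) * b n) atTop (𝓝 κ)) :
    ∑' n, coeff n (eulerDiff b) = κ := by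
  refine HasSum.tsum_eq ((hasSum_iff_tendsto_nat_of_nonneg h κ).2 ?_)
  rw [← tendsto_add_atTop_iff_nat 1]
  refine hb.congr fun n => ?_
  rw [eulerDiff, sum_range_coeff_one_sub_X_mul, coeff_X_mul_derivative, coeff_mk]

lemma one_sub_X_mul_mk_tail (b : ℕ → ℝ) : (1 - X) * mk (tail b) = (mk b)⁻¹ := by
  rw [inv_mk_eq_one_sub_recipDefect]
  ext n
  rw [sub_mul, one_mul, map_sub]
  rcases n with _ | n
  · simp [tail]
  · rw [coeff_succ_X_mul]
    simp [tail, coeff_one, Finset.sum_range_succ]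

lemma X_mul_derivative_recipDefect_eq_eulerDiff_mul (b : ℕ → ℝ) :
    X * d⁄dX ℝ (recipDefect b) = eulerDiff b * ((mk b)⁻¹ * mk (tail b)) := by
  rw [X_mul_derivative_recipDefect, eulerDiff]
  nth_rw 2 [← one_sub_X_mul_mk_tail]
  ring

lemma sum_antidiagonal_mul_tail (hb : b 0 = 1) (n : ℕ) :
    ∑ p ∈ antidiagonal n, b p.1 * tail b p.2 = 1 := by
  have hprod : mk b * mk (tail b) = mk 1 := by
    linear_combination mk 1 * mk_mul_inv_mk hb + mk b * mk 1 * one_sub_X_mul_mk_tail b -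
      mk b * mk (tail b) * mk_one_mul_one_sub_eq_one ℝ
  simpa [coeff_mul] using congrArg (coeff n) hprod

namespace IsKaluza

lemma tail_nonneg (hb : IsKaluza b) (n : ℕ) : 0 ≤ tail b n :=
  sub_nonneg.2 (hb.sum_coeff_recipDefect_le_one _)

lemma tail_antitone (hb : IsKaluza b) : Antitone (tail b) := by
  refine antitone_nat_of_succ_le fun n => ?_
  rw [tail, tail, Finset.sum_range_succ _ (n + 1)]
  linarith [hb.coeff_recipDefect_nonneg (n + 1)]

lemma tail_mul_sum_le_one (hb : IsKaluza b) (n : ℕ) :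
    tail b n * ∑ k ∈ range (n + 1), b k ≤ 1 := by
  rw [← sum_antidiagonal_mul_tail hb.zero n,
    Finset.Nat.sum_antidiagonal_eq_sum_range_succ fun i j => b i * tail b j, Finset.mul_sum]
  refine Finset.sum_le_sum fun k _ => ?_
  rw [mul_comm]
  exact mul_le_mul_of_nonneg_left (hb.tail_antitone (Nat.sub_le _ _)) (hb.pos k).le

lemma one_le_tail_mul_sum (hb : IsKaluza b) (n : ℕ) :
    1 ≤ tail b n * ∑ k ∈ range (n + 1), b k + b n * ∑ j ∈ range (n + 1), tail b j := by
  have hsplit := coeff_mul_eq_sum_half_add_sum_half (PowerSeries.mk b) (PowerSeries.mk (tail b))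
    (2 * n)
  rw [coeff_mul, show 2 * n / 2 + 1 = n + 1 by omega, show (2 * n + 1) / 2 = n by omega] at hsplit
  simp only [coeff_mk] at hsplit
  rw [← sum_antidiagonal_mul_tail hb.zero (2 * n), hsplit, Finset.mul_sum, Finset.mul_sum]
  refine add_le_add (Finset.sum_le_sum fun k hk => ?_) ?_
  · rw [mul_comm]
    have := Finset.mem_range.1 hk
    exact mul_le_mul_of_nonneg_right (hb.tail_antitone (by omega)) (hb.pos k).le
  · rw [Finset.sum_range_succ]
    refine le_add_of_le_of_nonneg (Finset.sum_le_sum fun j hj => ?_)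
      (mul_nonneg (hb.pos n).le (hb.tail_nonneg n))
    rw [mul_comm]
    have := Finset.mem_range.1 hj
    exact mul_le_mul_of_nonneg_right (hb.antitone (by omega)) (hb.tail_nonneg j)

end IsKaluza

lemma coeff_inv_mk_mul_mk_tail (b : ℕ → ℝ) (n : ℕ) :
    coeff n ((mk b)⁻¹ * mk (tail b)) = tail b n ^ 2 -
      ∑ k ∈ range (n + 1), coeff k (recipDefect b) * (tail b (n - k) - tail b n) := by
  have hsum : ∑ k ∈ range (n + 1), coeff k (recipDefect b) = 1 - tail b n :=
    (sub_sub_cancel _ _).symm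
  rw [inv_mk_eq_one_sub_recipDefect, sub_mul, one_mul, map_sub, coeff_mul,
    Finset.Nat.sum_antidiagonal_eq_sum_range_succ
      fun i j => coeff i (recipDefect b) * coeff j (mk (tail b))]
  simp only [coeff_mk, mul_sub, Finset.sum_sub_distrib, ← Finset.sum_mul]
  rw [hsum]
  ring

lemma IsKaluza.tail_defect_nonneg (hb : IsKaluza b) (n k : ℕ) :
    0 ≤ coeff k (recipDefect b) * (tail b (n - k) - tail b n) :=
  mul_nonneg (hb.coeff_recipDefect_nonneg k) (sub_nonneg.2 (hb.tail_antitone (Nat.sub_le _ _)))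

lemma IsKaluza.tail_defect_le (hb : IsKaluza b) {n k : ℕ} {c : ℝ} (hkn : k ≤ n)
    (hc : ∀ j ≤ n, n ≤ 2 * j → coeff j (recipDefect b) ≤ c) :
    coeff k (recipDefect b) * (tail b (n - k) - tail b n) ≤
      c * (k * coeff k (recipDefect b) + tail b (n - k)) := by
  have hc0 : 0 ≤ c := (hb.coeff_recipDefect_nonneg n).trans (hc n le_rfl (by omega))
  have hak := hb.coeff_recipDefect_nonneg k
  have hT := hb.tail_nonneg (n - k)
  rcases le_or_gt (2 * k) n with hk | hk
  · have hblock : tail b (n - k) - tail b n ≤ k * c := by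
      have hsum := Finset.sum_le_card_nsmul (Finset.Ico (n - k + 1) (n + 1))
        (fun j => coeff j (recipDefect b)) c fun j hj => by
          have := Finset.mem_Ico.1 hj
          exact hc j (by omega) (by omega)
      rw [Finset.sum_Ico_eq_sub _ (by omega), Nat.card_Ico, show n + 1 - (n - k + 1) = k by omega,
        nsmul_eq_mul] at hsum
      simpa [tail] using hsum
    have := mul_le_mul_of_nonneg_left hblock hak
    have := mul_nonneg hc0 hT
    linarith
  · have hdiff : tail b (n - k) - tail b n ≤ tail b (n - k) := sub_le_self _ (hb.tail_nonneg n)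
    have := mul_le_mul (hc k hkn hk.le) hdiff
      (sub_nonneg.2 (hb.tail_antitone (Nat.sub_le n k))) hc0
    have := mul_nonneg hc0 (mul_nonneg (k.cast_nonneg (α := ℝ)) hak)
    linarith

lemma IsKaluza.sum_tail_defect_le (hb : IsKaluza b) {n : ℕ} {c : ℝ}
    (hc : ∀ j ≤ n, n ≤ 2 * j → coeff j (recipDefect b) ≤ c) :
    ∑ k ∈ range (n + 1), coeff k (recipDefect b) * (tail b (n - k) - tail b n) ≤
      c * (∑ k ∈ range (n + 1), |k * coeff k (recipDefect b)| +
        ∑ k ∈ range (n + 1), |tail b k|) := by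
  rw [← Finset.sum_range_reflect (fun k => |tail b k|), ← Finset.sum_add_distrib, Finset.mul_sum]
  refine Finset.sum_le_sum fun k hk => ?_
  rw [abs_of_nonneg (mul_nonneg k.cast_nonneg (hb.coeff_recipDefect_nonneg k)),
    abs_of_nonneg (hb.tail_nonneg _), Nat.add_sub_cancel]
  exact hb.tail_defect_le (Finset.mem_range_succ_iff.1 hk) hc

lemma isBigO_of_isBigO_natCast_mul {x : ℕ → ℝ} (hv : ∀ n, 0 < v n)
    (h : (fun n : ℕ => (n : ℝ) * x n) =O[atTop] v) : x =O[atTop] fun n => v n / ((n : ℝ) + 1) := by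
  obtain ⟨M, -, hM⟩ := exists_abs_le_of_isBigO hv h
  refine IsBigO.of_bound (2 * M) ?_
  filter_upwards [eventually_ge_atTop 1] with n hn
  have hn1 : (1 : ℝ) ≤ n := by exact_mod_cast hn
  have hbound := hM n
  rw [abs_mul, Nat.abs_cast] at hbound
  rw [Real.norm_of_nonneg (div_pos (hv n) (by positivity)).le, Real.norm_eq_abs, ← mul_div_assoc,
    le_div_iff₀ (by positivity)]
  nlinarith [abs_nonneg (x n)]

lemma IsKaluza.isBigO_coeff_recipDefect_div_succ (hb : IsKaluza b) (hv : IsTempered v)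
    (hv0 : Tendsto v atTop (𝓝 0))
    (huv : (fun n : ℕ => ((n : ℝ) + 1) * ((n : ℝ) + 1) ^ (-2 : ℝ)) =O[atTop] v)
    (hp0 : ∀ n, 0 ≤ coeff n (eulerDiff b))
    (hp : (fun n => coeff n (eulerDiff b)) =O[atTop] fun n : ℕ => ((n : ℝ) + 1) ^ (-2 : ℝ))
    (hT : Tendsto (fun n => tail b n ^ 2 / v n) atTop (𝓝 β)) :
    (fun n => coeff n (recipDefect b)) =O[atTop] fun n => v n / ((n : ℝ) + 1) := by
  refine isBigO_of_isBigO_natCast_mul hv.pos (IsBigO.trans ?_ (isBigO_of_tendsto_div hv.pos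
    (tendsto_coeff_mul_div_of_isBigO (g := PowerSeries.mk fun n => tail b n ^ 2)
      (isTempered_rpow (-2)) (summable_rpow_neg one_lt_two) hv hv0 huv hp
        (by simpa only [coeff_mk] using hT))))
  refine IsBigO.of_norm_le fun n => ?_
  have hle : ∀ k, coeff k ((PowerSeries.mk b)⁻¹ * PowerSeries.mk (tail b)) ≤ tail b k ^ 2 :=
    fun k => (coeff_inv_mk_mul_mk_tail b k).trans_le
      (sub_le_self _ (Finset.sum_nonneg fun _ _ => hb.tail_defect_nonneg k _))
  rw [Real.norm_of_nonneg (mul_nonneg n.cast_nonneg (hb.coeff_recipDefect_nonneg n)),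
    ← coeff_X_mul_derivative, X_mul_derivative_recipDefect_eq_eulerDiff_mul, coeff_mul, coeff_mul]
  refine Finset.sum_le_sum fun p _ => ?_
  rw [coeff_mk]
  exact mul_le_mul_of_nonneg_left (hle _) (hp0 _)

lemma IsKaluza.tendsto_sum_tail_defect_div (hb : IsKaluza b) (hv : IsTempered v)
    (hv0 : Tendsto v atTop (𝓝 0)) (hT0 : Tendsto (tail b) atTop (𝓝 0))
    (ha : (fun n => coeff n (recipDefect b)) =O[atTop] fun n => v n / ((n : ℝ) + 1)) :
    Tendsto (fun n => (∑ k ∈ range (n + 1),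
      coeff k (recipDefect b) * (tail b (n - k) - tail b n)) / v n) atTop (𝓝 0) := by
  obtain ⟨Q, hQ0, hQ⟩ := exists_abs_le_of_isBigO hv.div_succ.pos ha
  obtain ⟨K, -, hK⟩ := hv.div_succ.doubling
  have hna0 : Tendsto (fun n : ℕ => (n : ℝ) * coeff n (recipDefect b)) atTop (𝓝 0) := by
    refine IsBigO.trans_tendsto (IsBigO.of_bound Q (Eventually.of_forall fun n => ?_)) hv0
    rw [norm_mul, Real.norm_natCast, Real.norm_of_nonneg (hv.pos n).le, Real.norm_eq_abs]
    have hvn := hv.pos n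
    calc (n : ℝ) * |coeff n (recipDefect b)| ≤ (n + 1) * (Q * (v n / (n + 1))) := by
          gcongr
          · linarith
          · exact hQ n
      _ = Q * v n := by field_simp
  have hcesaro := ((tendsto_cesaro_abs_of_tendsto_zero hna0).add
    (tendsto_cesaro_abs_of_tendsto_zero hT0)).const_mul (Q * K)
  rw [add_zero, mul_zero] at hcesaro
  refine squeeze_zero (fun n => div_nonneg
    (Finset.sum_nonneg fun k _ => hb.tail_defect_nonneg n k) (hv.pos n).le) (fun n => ?_) hcesaro
  have hmax : ∀ j ≤ n, n ≤ 2 * j → coeff j (recipDefect b) ≤ Q * (K * (v n / ((n : ℝ) + 1))) :=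
    fun j hj hn => (le_abs_self _).trans
      ((hQ j).trans (mul_le_mul_of_nonneg_left (hK hj hn) hQ0))
  rw [div_le_iff₀ (hv.pos n)]
  refine (hb.sum_tail_defect_le hmax).trans_eq ?_
  field_simp

theorem IsKaluza.tendsto_coeff_recipDefect_div_of_tail (hb : IsKaluza b) (hv : IsTempered v)
    (hv0 : Tendsto v atTop (𝓝 0))
    (huv : (fun n : ℕ => ((n : ℝ) + 1) * ((n : ℝ) + 1) ^ (-2 : ℝ)) =O[atTop] v)
    (hp0 : ∀ n, 0 ≤ coeff n (eulerDiff b))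
    (hp : (fun n => coeff n (eulerDiff b)) =O[atTop] fun n : ℕ => ((n : ℝ) + 1) ^ (-2 : ℝ))
    (hT : Tendsto (fun n => tail b n ^ 2 / v n) atTop (𝓝 β)) :
    Tendsto (fun n => coeff n (recipDefect b) / (v n / ((n : ℝ) + 1))) atTop
      (𝓝 (β * ∑' n, coeff n (eulerDiff b))) := by
  have hT0 : Tendsto (tail b) atTop (𝓝 0) := by
    have hsqrt := (tendsto_zero_of_tendsto_div hv.pos hv0 hT).sqrt
    simpa only [Real.sqrt_zero, Real.sqrt_sq (hb.tail_nonneg _)] using hsqrt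
  have ha := hb.isBigO_coeff_recipDefect_div_succ hv hv0 huv hp0 hp hT
  have hE : Tendsto (fun n => coeff n ((PowerSeries.mk b)⁻¹ * PowerSeries.mk (tail b)) / v n) atTop
      (𝓝 β) := by
    simpa only [coeff_inv_mk_mul_mk_tail, sub_div, sub_zero] using
      hT.sub (hb.tendsto_sum_tail_defect_div hv hv0 hT0 ha)
  rw [← tendsto_coeff_X_mul_derivative_div_iff hv.div_succ.pos,
    X_mul_derivative_recipDefect_eq_eulerDiff_mul]
  refine (tendsto_coeff_mul_div_of_isBigO (isTempered_rpow (-2)) (summable_rpow_neg one_lt_two)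
    hv hv0 huv hp hE).congr fun n => ?_
  rw [mul_div_cancel₀ (v n) (by positivity : (n : ℝ) + 1 ≠ 0)]

end Tail

section LogWeight

variable {b : ℕ → ℝ} {κ : ℝ}

lemma tendsto_sum_inv_div_log :
    Tendsto (fun n : ℕ => (∑ k ∈ range (n + 1), 1 / ((k : ℝ) + 1)) / Real.log ((n : ℝ) + 2)) atTop
      (𝓝 1) := by
  have hgamma := ((Real.tendsto_harmonic_sub_log_add_one.comp (tendsto_add_atTop_nat 1)).mul
    tendsto_log_add_two.inv_tendsto_atTop).add_const 1
  rw [mul_zero, zero_add] at hgamma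
  refine hgamma.congr fun n => ?_
  have hlog := log_add_two_pos n
  have hcast : (((n + 1 : ℕ) : ℝ) + 1) = n + 2 := by push_cast; ring
  have hharm : ((harmonic (n + 1) : ℚ) : ℝ) = ∑ k ∈ range (n + 1), 1 / ((k : ℝ) + 1) := by
    simp [harmonic]
  simp only [Function.comp, Pi.inv_apply]
  rw [hharm, hcast]
  field_simp
  ring

lemma tendsto_atTop_of_tendsto_div {x y : ℕ → ℝ} (hy : Tendsto y atTop atTop)
    (hy0 : ∀ n, 0 < y n) (hκ : 0 < κ) (h : Tendsto (fun n => x n / y n) atTop (𝓝 κ)) :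
    Tendsto x atTop atTop :=
  (hy.atTop_mul_pos hκ h).congr fun n => mul_div_cancel₀ (x n) (hy0 n).ne'

lemma tendsto_sum_div_log (hb : Tendsto (fun n : ℕ => ((n : ℝ) + 1) * b n) atTop (𝓝 κ)) :
    Tendsto (fun n : ℕ => (∑ k ∈ range (n + 1), b k) / Real.log ((n : ℝ) + 2)) atTop (𝓝 κ) := by
  have hdiv : Tendsto (fun n : ℕ => ∑ k ∈ range n, 1 / ((k : ℝ) + 1)) atTop atTop :=
    (tendsto_add_atTop_iff_nat 1).1 (tendsto_atTop_of_tendsto_div tendsto_log_add_two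
      log_add_two_pos one_pos tendsto_sum_inv_div_log)
  have hlittle : (fun k : ℕ => b k - κ * (1 / ((k : ℝ) + 1))) =o[atTop]
      fun k : ℕ => 1 / ((k : ℝ) + 1) := by
    refine (isLittleO_iff_tendsto fun k hk => absurd hk (by positivity)).2 ?_
    refine (sub_self κ ▸ hb.sub_const κ).congr fun n => ?_
    field_simp
  have hsum := ((((hlittle.sum_range (fun n => by positivity) hdiv).tendsto_div_nhds_zero.comp
    (tendsto_add_atTop_nat 1)).add_const κ).mul tendsto_sum_inv_div_log)
  rw [zero_add, mul_one] at hsum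
  refine hsum.congr fun n => ?_
  have hlog := log_add_two_pos n
  rw [Function.comp, Finset.sum_sub_distrib, ← Finset.mul_sum]
  field_simp
  ring

namespace IsKaluza

lemma sum_range_succ_pos (hb : IsKaluza b) (n : ℕ) : 0 < ∑ k ∈ range (n + 1), b k :=
  Finset.sum_pos (fun k _ => hb.pos k) Finset.nonempty_range_add_one

lemma tendsto_tail_zero (hb : IsKaluza b)
    (hsum : Tendsto (fun n => ∑ k ∈ range (n + 1), b k) atTop atTop) :
    Tendsto (tail b) atTop (𝓝 0) := by
  refine squeeze_zero hb.tail_nonneg (fun n => ?_) hsum.inv_tendsto_atTop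
  rw [Pi.inv_apply, inv_eq_one_div, le_div_iff₀ (hb.sum_range_succ_pos n)]
  exact hb.tail_mul_sum_le_one n

lemma tendsto_tail_mul_log (hb : IsKaluza b) (hκ : 0 < κ)
    (hbκ : Tendsto (fun n : ℕ => ((n : ℝ) + 1) * b n) atTop (𝓝 κ)) :
    Tendsto (fun n : ℕ => tail b n * Real.log ((n : ℝ) + 2)) atTop (𝓝 κ⁻¹) := by
  have hS := tendsto_sum_div_log hbκ
  have hT0 := hb.tendsto_tail_zero
    (tendsto_atTop_of_tendsto_div tendsto_log_add_two log_add_two_pos hκ hS)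
  have hTS : Tendsto (fun n => tail b n * ∑ k ∈ range (n + 1), b k) atTop (𝓝 1) := by
    have hlower := ((tendsto_cesaro_abs_of_tendsto_zero hT0).mul hbκ).const_sub 1
    rw [zero_mul, sub_zero] at hlower
    refine tendsto_of_tendsto_of_tendsto_of_le_of_le hlower tendsto_const_nhds (fun n => ?_)
      hb.tail_mul_sum_le_one
    simp only [abs_of_nonneg (hb.tail_nonneg _)]
    rw [← mul_assoc, div_mul_cancel₀ _ (by positivity : (n : ℝ) + 1 ≠ 0), mul_comm,
      sub_le_iff_le_add]
    exact hb.one_le_tail_mul_sum n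
  refine (one_div κ ▸ hTS.div hS hκ.ne').congr fun n => ?_
  have hlog := log_add_two_pos n
  have hpos := hb.sum_range_succ_pos n
  rw [Pi.div_apply]
  field_simp

theorem tendsto_coeff_recipDefect_div_logWeight (hb : IsKaluza b) (hκ : 0 < κ)
    (hbκ : Tendsto (fun n : ℕ => ((n : ℝ) + 1) * b n) atTop (𝓝 κ))
    (hp0 : ∀ n, 0 ≤ coeff n (eulerDiff b))
    (hp : (fun n => coeff n (eulerDiff b)) =O[atTop] fun n : ℕ => ((n : ℝ) + 1) ^ (-2 : ℝ)) :
    Tendsto (fun n => coeff n (recipDefect b) / (logWeight n / ((n : ℝ) + 1))) atTop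
      (𝓝 κ⁻¹) := by
  have hnb : Tendsto (fun n : ℕ => (n : ℝ) * b n) atTop (𝓝 κ) := by
    refine (one_mul κ ▸ tendsto_natCast_div_natCast_add_one.mul hbκ).congr fun n => ?_
    field_simp
  have hT : Tendsto (fun n => tail b n ^ 2 / logWeight n) atTop (𝓝 (κ⁻¹ ^ 2)) :=
    ((hb.tendsto_tail_mul_log hκ hbκ).pow 2).congr fun n => by
      rw [logWeight, div_div_eq_mul_div, div_one, mul_pow]
  have h := hb.tendsto_coeff_recipDefect_div_of_tail isTempered_logWeight tendsto_logWeight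
    isBigO_succ_mul_rpow_neg_two_logWeight hp0 hp hT
  rwa [tsum_coeff_eulerDiff hp0 hnb, sq, mul_assoc, inv_mul_cancel₀ hκ.ne', mul_one] at h

lemma summable_of_tendsto_coeff_recipDefect_div {w : ℕ → ℝ} {α : ℝ} (hb : IsKaluza b)
    (hα : α ≠ 0) (h : Tendsto (fun n => coeff n (recipDefect b) / w n) atTop (𝓝 α)) :
    Summable w :=
  summable_of_isBigO_nat hb.summable_coeff_recipDefect (isBigO_of_tendsto_div_ne_zero hα h)

end IsKaluza

end LogWeight

section KaluzaExponential

variable {b h w : ℕ → ℝ} {L α : ℝ}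

lemma constantCoeff_quotSeries (hh : h 0 = 0) : constantCoeff (quotSeries b h) = 0 := by
  rw [← coeff_zero_eq_constantCoeff_apply, coeff_zero_quotSeries hh]

namespace IsKaluza

lemma coeff_expSeries_quotSeries_nonneg (hb : IsKaluza b) (hh0 : h 0 = 0) (hh : Monotone h)
    (n : ℕ) : 0 ≤ coeff n (expSeries (quotSeries b h)) := by
  have hg := constantCoeff_quotSeries (b := b) hh0
  refine coeff_nonneg_of_derivative_eq_mul (derivative_expSeries hg) ?_
    (hb.coeff_quotSeries_nonneg hh0.ge hh) n
  rw [constantCoeff_expSeries hg]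
  exact zero_le_one

lemma isSumOn_mk (hb : IsKaluza b) :
    IsSumOn (complexify (PowerSeries.mk b)) (fun z => ∑' n, (b n : ℂ) * z ^ n) 1 := by
  refine (isSumOn_of_bounded (M := 1) fun n => ?_).congr fun z _ => by simp
  rw [coeff_map, coeff_mk, Complex.ofRealHom_eq_coe, Complex.norm_real,
    Real.norm_of_nonneg (hb.pos n).le]
  exact hb.le_one n

lemma isSumOn_mk_mul (hb : IsKaluza b) (hh0 : ∀ n, 0 ≤ h n) (hhL : ∀ n, h n ≤ L) :
    IsSumOn (complexify (PowerSeries.mk fun n => h n * b n))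
      (fun z => ∑' n, (h n : ℂ) * (b n : ℂ) * z ^ n) 1 := by
  refine (isSumOn_of_bounded (M := L) fun n => ?_).congr fun z _ => by simp
  rw [coeff_map, coeff_mk, Complex.ofRealHom_eq_coe, Complex.norm_real,
    Real.norm_of_nonneg (mul_nonneg (hh0 n) (hb.pos n).le)]
  exact (mul_le_of_le_one_right (hh0 n) (hb.le_one n)).trans (hhL n)

lemma isSumOn_inv_mk (hb : IsKaluza b) :
    IsSumOn (complexify (PowerSeries.mk b)⁻¹) (fun z => (∑' n, (b n : ℂ) * z ^ n)⁻¹) 1 := by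
  have hb0 : constantCoeff (PowerSeries.mk b) ≠ 0 := by simp [hb.zero]
  have hbound : ∀ n, ‖coeff n (complexify (PowerSeries.mk b)⁻¹)‖ ≤ 1 := fun n => by
    rw [coeff_map, Complex.ofRealHom_eq_coe, Complex.norm_real, inv_mk_eq_one_sub_recipDefect,
      map_sub, coeff_one]
    rcases n with _ | n
    · simp [coeff_zero_recipDefect hb.zero]
    · rw [if_neg n.succ_ne_zero, zero_sub, norm_neg,
        Real.norm_of_nonneg (hb.coeff_recipDefect_nonneg _)]
      exact (hb.coeff_recipDefect_le _).trans (hb.le_one _)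
  have hsum := isSumOn_of_bounded hbound
  rw [complexify_inv hb0] at hsum ⊢
  refine hb.isSumOn_mk.inv hsum ?_
  rw [← coeff_zero_eq_constantCoeff_apply, coeff_map, coeff_mk, hb.zero, map_one]
  exact one_ne_zero

lemma isSumOn_expSeries_quotSeries (hb : IsKaluza b) (hh0 : h 0 = 0) (hh : Monotone h)
    (hhL : ∀ n, h n ≤ L) :
    IsSumOn (complexify (expSeries (quotSeries b h)))
      (fun z => Complex.exp
        ((∑' n, (h n : ℂ) * (b n : ℂ) * z ^ n) / ∑' n, (b n : ℂ) * z ^ n)) 1 := by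
  refine isSumOn_expSeries one_pos (constantCoeff_quotSeries hh0) ?_
  simp only [div_eq_mul_inv]
  rw [quotSeries, complexify, map_mul]
  exact (hb.isSumOn_mk_mul (fun n => hh0.ge.trans (hh n.zero_le)) hhL).mul hb.isSumOn_inv_mk

lemma sum_coeff_expSeries_quotSeries_le (hb : IsKaluza b) (hh0 : h 0 = 0) (hh : Monotone h)
    (hhL : ∀ n, h n ≤ L) (n : ℕ) :
    ∑ i ∈ range n, coeff i (expSeries (quotSeries b h)) ≤ Real.exp L := by
  have hL : 0 ≤ L := hh0.ge.trans (hhL 0)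
  have hpos : ∀ n, 0 ≤ h n := fun n => hh0.ge.trans (hh n.zero_le)
  have hle := (hb.isSumOn_expSeries_quotSeries hh0 hh hhL).sum_coeff_mul_pow_le one_pos
    (hb.coeff_expSeries_quotSeries_nonneg hh0 hh) (M := Real.exp L) ?_ n
  · simpa only [one_pow, mul_one] using hle
  filter_upwards [Ioo_mem_nhdsLT one_pos] with x hx
  refine (Complex.norm_exp_le_exp_norm _).trans (Real.exp_le_exp.2 ?_)
  rw [norm_div]
  refine div_le_of_le_mul₀ (norm_nonneg _) hL (IsSumOn.norm_le_mul_norm hL (fun n => ?_)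
    hb.isSumOn_mk (hb.isSumOn_mk_mul hpos hhL) hx.1.le hx.2)
  rw [coeff_mk, coeff_mk, abs_of_nonneg (mul_nonneg (hpos n) (hb.pos n).le)]
  exact mul_le_mul_of_nonneg_right (hhL n) (hb.pos n).le

lemma summable_coeff_expSeries_quotSeries (hb : IsKaluza b) (hh0 : h 0 = 0) (hh : Monotone h)
    (hhL : ∀ n, h n ≤ L) : Summable fun n => coeff n (expSeries (quotSeries b h)) :=
  summable_of_sum_range_le (hb.coeff_expSeries_quotSeries_nonneg hh0 hh)
    (hb.sum_coeff_expSeries_quotSeries_le hh0 hh hhL)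

theorem exists_tendsto_coeff_expSeries_quotSeries_div (hb : IsKaluza b) (hh0 : h 0 = 0)
    (hh : Monotone h) (hhL : ∀ n, h n < L) (hw : IsTempered w) (hws : Summable w)
    (hw0 : Tendsto (fun n : ℕ => ((n : ℝ) + 1) * w n) atTop (𝓝 0)) (hα : 0 < α)
    (ha : Tendsto (fun n => coeff n (recipDefect b) / w n) atTop (𝓝 α))
    (hd : Tendsto (fun n => (L - h n) * b n / w n) atTop (𝓝 0)) :
    ∃ c, 0 < c ∧
      Tendsto (fun n => coeff n (expSeries (quotSeries b h)) / w n) atTop (𝓝 c) := by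
  have hg := constantCoeff_quotSeries (b := b) hh0
  have hle : ∀ n, h n ≤ L := fun n => (hhL n).le
  have hsum := hb.summable_coeff_expSeries_quotSeries hh0 hh hle
  refine ⟨_, ?_, tendsto_coeff_expSeries_div hw hws hw0 hg
    (tendsto_coeff_quotSeries_div hb.zero hw hws ha hd) hsum⟩
  have hterm : ∀ n, 0 < (L - h n) * b n := fun n => mul_pos (sub_pos.2 (hhL n)) (hb.pos n)
  have hexp0 : 0 < coeff 0 (expSeries (quotSeries b h)) := by
    rw [coeff_zero_eq_constantCoeff_apply, constantCoeff_expSeries hg]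
    exact one_pos
  exact mul_pos (mul_pos hα ((summable_of_isBigO_nat hws
    (isBigO_of_tendsto_div hw.pos hd)).tsum_pos (fun n => (hterm n).le) 0 (hterm 0)))
    (hsum.tsum_pos (hb.coeff_expSeries_quotSeries_nonneg hh0 hh) 0 hexp0)

end IsKaluza

end KaluzaExponential

section Parameters

variable {ι : Type*} {s : Finset ι} {x : ι → ℝ} {L : ℝ}

/-- The products `∏ᵢ (xᵢ)ₘ / m!`, over an arbitrary finite family of parameters `xᵢ`. -/
def pochSeq (s : Finset ι) (x : ι → ℝ) (m : ℕ) : ℝ :=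
  ∏ i ∈ s, (ascPochhammer ℝ m).eval (x i) / (m.factorial : ℝ)

/-- The sums `∑ᵢ (H(xᵢ, m) - H(1, m))`, over an arbitrary finite family of parameters `xᵢ`. -/
def harmSeq (s : Finset ι) (x : ι → ℝ) (m : ℕ) : ℝ :=
  ∑ i ∈ s, (harm (x i) m - harm 1 m)

lemma pochSeq_zero (s : Finset ι) (x : ι → ℝ) : pochSeq s x 0 = 1 := by simp [pochSeq]

lemma pochSeq_succ (s : Finset ι) (x : ι → ℝ) (m : ℕ) :
    pochSeq s x (m + 1) = pochSeq s x m * ∏ i ∈ s, ((x i + m) / ((m : ℝ) + 1)) := by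
  rw [pochSeq, pochSeq, ← Finset.prod_mul_distrib]
  refine Finset.prod_congr rfl fun i _ => ?_
  rw [ascPochhammer_succ_eval, Nat.factorial_succ]
  have : (m.factorial : ℝ) ≠ 0 := Nat.cast_ne_zero.2 m.factorial_ne_zero
  push_cast
  field_simp

lemma harmSeq_zero (s : Finset ι) (x : ι → ℝ) : harmSeq s x 0 = 0 := by simp [harmSeq, harm]

lemma harmSeq_succ (s : Finset ι) (x : ι → ℝ) (m : ℕ) :
    harmSeq s x (m + 1) = harmSeq s x m + ∑ i ∈ s, (1 / (x i + m) - 1 / (1 + (m : ℝ))) := by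
  rw [harmSeq, harmSeq, ← Finset.sum_add_distrib]
  refine Finset.sum_congr rfl fun i _ => ?_
  simp only [harm, Finset.sum_range_succ]
  ring

lemma pochSeq_pos (hx : ∀ i ∈ s, 0 < x i) (m : ℕ) : 0 < pochSeq s x m :=
  Finset.prod_pos fun i hi => div_pos (ascPochhammer_pos m _ (hx i hi)) (by positivity)

lemma isKaluza_pochSeq (hx : ∀ i ∈ s, 0 < x i) (hx1 : ∀ i ∈ s, x i ≤ 1) :
    IsKaluza (pochSeq s x) where
  zero := pochSeq_zero s x
  pos := pochSeq_pos hx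
  antitone := by
    refine antitone_nat_of_succ_le fun m => ?_
    rw [pochSeq_succ]
    refine mul_le_of_le_one_right (pochSeq_pos hx m).le
      (Finset.prod_le_one (fun i hi => ?_) fun i hi => ?_)
    · have := hx i hi
      positivity
    · rw [div_le_one (by positivity)]
      linarith [hx1 i hi]
  logConvex := by
    refine monotone_nat_of_le_succ fun m => ?_
    simp only [pochSeq_succ s x m, pochSeq_succ s x (m + 1)]
    rw [mul_div_cancel_left₀ _ (pochSeq_pos hx m).ne', ← pochSeq_succ s x m,
      mul_div_cancel_left₀ _ (pochSeq_pos hx (m + 1)).ne']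
    refine Finset.prod_le_prod (fun i hi => ?_) fun i hi => ?_
    · have := hx i hi
      positivity
    · rw [div_le_div_iff₀ (by positivity) (by positivity)]
      push_cast
      nlinarith [hx1 i hi]

lemma strictMono_harmSeq (hs : s.Nonempty) (hx : ∀ i ∈ s, 0 < x i) (hx1 : ∀ i ∈ s, x i < 1) :
    StrictMono (harmSeq s x) := by
  refine strictMono_nat_of_lt_succ fun m => ?_
  rw [harmSeq_succ]
  refine lt_add_of_pos_right _ (Finset.sum_pos (fun i hi => sub_pos.2 ?_) hs)
  have hpos := hx i hi
  exact one_div_lt_one_div_of_lt (by positivity) (by linarith [hx1 i hi])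

lemma lt_of_strictMono_of_tendsto {h : ℕ → ℝ} (hh : StrictMono h) (hL : Tendsto h atTop (𝓝 L))
    (n : ℕ) : h n < L :=
  (hh n.lt_succ_self).trans_le (hh.monotone.ge_of_tendsto hL _)

lemma prod_range_add_natCast (y : ℝ) (n : ℕ) :
    ∏ j ∈ range n, (y + (j : ℝ)) = (ascPochhammer ℝ n).eval y := by
  induction n with
  | zero => simp
  | succ n ih => rw [Finset.prod_range_succ, ih, ascPochhammer_succ_eval]

lemma tendsto_ascPochhammer_div_factorial {y : ℝ} (hy : 0 < y) :
    Tendsto (fun m : ℕ => (ascPochhammer ℝ m).eval y / (m.factorial : ℝ) * ((m : ℝ) + 1) ^ (1 - y))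
      atTop (𝓝 (Real.Gamma y)⁻¹) := by
  have hgamma := (Real.GammaSeq_tendsto_Gamma y).inv₀ (Real.Gamma_pos_of_pos hy).ne'
  have hpow := tendsto_natCast_div_natCast_add_one.rpow_const (p := y) (Or.inl one_ne_zero)
  have hratio := (tendsto_natCast_div_add_atTop (𝕜 := ℝ) y).div
    tendsto_natCast_div_natCast_add_one one_ne_zero
  have hprod := (hgamma.mul hpow).mul hratio
  rw [Real.one_rpow, div_one, mul_one, mul_one] at hprod
  refine hprod.congr' ?_
  filter_upwards [eventually_gt_atTop 0] with n hn
  have hn0 : (0 : ℝ) < n := by exact_mod_cast hn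
  have hpoch := ascPochhammer_pos n y hy
  rw [Real.GammaSeq, Pi.div_apply, prod_range_add_natCast, ascPochhammer_succ_eval,
    Real.div_rpow hn0.le (by positivity), Real.rpow_sub (by positivity), Real.rpow_one,
    add_comm y]
  field_simp

lemma exists_tendsto_pochSeq_div (hx : ∀ i ∈ s, 0 < x i)
    (hsum : ∑ i ∈ s, x i = (s.card : ℝ) / 2) :
    ∃ κ, 0 < κ ∧ Tendsto (fun m : ℕ => pochSeq s x m / ((m : ℝ) + 1) ^ (-((s.card : ℝ) / 2)))
      atTop (𝓝 κ) := by
  refine ⟨∏ i ∈ s, (Real.Gamma (x i))⁻¹,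
    Finset.prod_pos fun i hi => inv_pos.2 (Real.Gamma_pos_of_pos (hx i hi)), ?_⟩
  refine (tendsto_finsetProd s fun i hi =>
    tendsto_ascPochhammer_div_factorial (hx i hi)).congr fun m => ?_
  rw [Finset.prod_mul_distrib, Real.rpow_neg (by positivity), div_inv_eq_mul, pochSeq,
    ← Real.rpow_sum_of_pos (by positivity), Finset.sum_sub_distrib, hsum, Finset.sum_const,
    nsmul_eq_mul, mul_one, sub_half]

lemma antitone_harmSeq_add_div (hx : ∀ i ∈ s, 0 < x i) :
    Antitone fun m : ℕ => harmSeq s x (m + 1) + s.card / ((m : ℝ) + 1) := by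
  refine antitone_nat_of_succ_le fun m => ?_
  have hstep : ∑ i ∈ s, (1 / (x i + (m + 1 : ℕ)) - 1 / (1 + ((m + 1 : ℕ) : ℝ))) ≤
      s.card • (1 / ((m : ℝ) + 1) - 1 / (1 + ((m + 1 : ℕ) : ℝ))) := by
    refine Finset.sum_le_card_nsmul _ _ _ fun i hi => sub_le_sub_right ?_ _
    exact one_div_le_one_div_of_le (by positivity) (by push_cast; linarith [hx i hi])
  rw [nsmul_eq_mul, mul_sub, mul_one_div, mul_one_div, add_comm 1] at hstep
  rw [harmSeq_succ s x (m + 1), add_comm 1]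
  linarith

lemma sub_harmSeq_le (hx : ∀ i ∈ s, 0 < x i) (hL : Tendsto (harmSeq s x) atTop (𝓝 L)) (n : ℕ) :
    L - harmSeq s x (n + 1) ≤ s.card / ((n : ℝ) + 1) := by
  have hlim := (hL.comp (tendsto_add_atTop_nat 1)).add
    ((tendsto_one_div_add_atTop_nhds_zero_nat (𝕜 := ℝ)).const_mul (s.card : ℝ))
  simp only [mul_zero, add_zero, mul_one_div, Function.comp] at hlim
  linarith [(antitone_harmSeq_add_div hx).le_of_tendsto hlim n]

theorem exists_tendsto_coeff_expSeries_div_rpow (hx : ∀ i ∈ s, 0 < x i) (hx1 : ∀ i ∈ s, x i < 1)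
    (hsum : ∑ i ∈ s, x i = (s.card : ℝ) / 2) (hcard : 3 ≤ s.card)
    (hL : Tendsto (harmSeq s x) atTop (𝓝 L)) :
    ∃ c, 0 < c ∧ Tendsto (fun n : ℕ =>
      coeff n (expSeries (quotSeries (pochSeq s x) (harmSeq s x))) /
        ((n : ℝ) + 1) ^ (-((s.card : ℝ) / 2))) atTop (𝓝 c) := by
  have hb := isKaluza_pochSeq hx fun i hi => (hx1 i hi).le
  have hh := strictMono_harmSeq (Finset.card_pos.1 (by omega)) hx hx1
  have hexp : (1 : ℝ) < (s.card : ℝ) / 2 := by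
    have : (3 : ℝ) ≤ s.card := by exact_mod_cast hcard
    linarith
  have hw := isTempered_rpow (-((s.card : ℝ) / 2))
  have hws := summable_rpow_neg hexp
  have hw0 := tendsto_succ_mul_rpow_neg hexp
  obtain ⟨κ, hκ, hbκ⟩ := exists_tendsto_pochSeq_div hx hsum
  obtain ⟨α, hα, ha⟩ := hb.exists_tendsto_coeff_recipDefect_div hw hws hw0 hκ hbκ
  have hd := (hL.const_sub L).mul hbκ
  rw [sub_self, zero_mul] at hd
  exact hb.exists_tendsto_coeff_expSeries_quotSeries_div (harmSeq_zero s x) hh.monotone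
    (lt_of_strictMono_of_tendsto hh hL) hw hws hw0 hα ha
    (hd.congr fun n => (mul_div_assoc _ _ _).symm)

end Parameters

section TwoParameters

variable {ι : Type*} {s : Finset ι} {x : ι → ℝ} {κ L : ℝ}

lemma coeff_succ_eulerDiff_pochSeq (hsum : ∑ i ∈ s, x i = (s.card : ℝ) / 2) (hcard : s.card = 2)
    (n : ℕ) : coeff (n + 1) (eulerDiff (pochSeq s x)) =
      (∏ i ∈ s, x i) * pochSeq s x n / ((n : ℝ) + 1) := by
  classical
  rw [coeff_succ_eulerDiff, pochSeq_succ]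
  obtain ⟨i, j, hij, rfl⟩ := Finset.card_eq_two.1 hcard
  rw [Finset.sum_pair hij, hcard] at hsum
  rw [Finset.prod_pair hij, Finset.prod_pair hij]
  have hxj : x j = 1 - x i := by
    rw [eq_sub_iff_add_eq', hsum]
    norm_num
  rw [hxj]
  field_simp
  ring

lemma coeff_eulerDiff_pochSeq_nonneg (hx : ∀ i ∈ s, 0 < x i)
    (hsum : ∑ i ∈ s, x i = (s.card : ℝ) / 2) (hcard : s.card = 2) (n : ℕ) :
    0 ≤ coeff n (eulerDiff (pochSeq s x)) := by
  rcases n with _ | n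
  · simp [eulerDiff]
  · rw [coeff_succ_eulerDiff_pochSeq hsum hcard]
    have hprod := Finset.prod_nonneg fun i hi => (hx i hi).le
    have hpoch := pochSeq_pos hx n
    positivity

lemma isBigO_coeff_eulerDiff_pochSeq (hsum : ∑ i ∈ s, x i = (s.card : ℝ) / 2)
    (hcard : s.card = 2)
    (hbκ : Tendsto (fun n : ℕ => ((n : ℝ) + 1) * pochSeq s x n) atTop (𝓝 κ)) :
    (fun n => coeff n (eulerDiff (pochSeq s x))) =O[atTop]
      fun n : ℕ => ((n : ℝ) + 1) ^ (-2 : ℝ) := by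
  have hratio := ((tendsto_one_div_add_atTop_nhds_zero_nat (𝕜 := ℝ)).const_add 1).pow 2
  refine isBigO_of_tendsto_div (fun n => by positivity) ((tendsto_add_atTop_iff_nat 1).1
    (((hbκ.const_mul (∏ i ∈ s, x i)).mul hratio).congr fun n => ?_))
  rw [coeff_succ_eulerDiff_pochSeq hsum hcard, Real.rpow_neg (by positivity), Real.rpow_two]
  push_cast
  field_simp

lemma tendsto_sub_harmSeq_mul_pochSeq_div_logWeight (hx : ∀ i ∈ s, 0 < x i)
    (hhL : ∀ n, harmSeq s x n < L) (hL : Tendsto (harmSeq s x) atTop (𝓝 L))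
    (hbκ : Tendsto (fun n : ℕ => ((n : ℝ) + 1) * pochSeq s x n) atTop (𝓝 κ)) :
    Tendsto (fun n => (L - harmSeq s x n) * pochSeq s x n / (logWeight n / ((n : ℝ) + 1))) atTop
      (𝓝 0) := by
  have hlog := (hbκ.comp (tendsto_add_atTop_nat 1)).mul
    ((tendsto_log_sq_div_succ.comp (tendsto_add_atTop_nat 1)).mul
      ((tendsto_one_div_add_atTop_nhds_zero_nat (𝕜 := ℝ)).const_add 1)) |>.const_mul (s.card : ℝ)
  rw [zero_mul, mul_zero, mul_zero] at hlog
  rw [← tendsto_add_atTop_iff_nat 1]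
  refine squeeze_zero (fun n => ?_) (fun n => ?_) hlog
  · exact div_nonneg (mul_nonneg (sub_nonneg.2 (hhL _).le) (pochSeq_pos hx _).le)
      (div_pos (logWeight_pos _) (by positivity)).le
  · have hpoch := pochSeq_pos hx (n + 1)
    have := log_add_two_pos (n + 1)
    refine (div_le_div_of_nonneg_right (mul_le_mul_of_nonneg_right (sub_harmSeq_le hx hL n)
      hpoch.le) (div_pos (logWeight_pos _) (by positivity)).le).trans_eq ?_
    simp only [Function.comp, logWeight]
    push_cast
    field_simp

theorem exists_tendsto_coeff_expSeries_div_logWeight (hx : ∀ i ∈ s, 0 < x i)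
    (hx1 : ∀ i ∈ s, x i < 1) (hsum : ∑ i ∈ s, x i = (s.card : ℝ) / 2) (hcard : s.card = 2)
    (hL : Tendsto (harmSeq s x) atTop (𝓝 L)) :
    ∃ c, 0 < c ∧ Tendsto (fun n : ℕ =>
      coeff n (expSeries (quotSeries (pochSeq s x) (harmSeq s x))) /
        (logWeight n / ((n : ℝ) + 1))) atTop (𝓝 c) := by
  have hb := isKaluza_pochSeq hx fun i hi => (hx1 i hi).le
  have hh := strictMono_harmSeq (Finset.card_pos.1 (by omega)) hx hx1
  have hhL := lt_of_strictMono_of_tendsto hh hL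
  obtain ⟨κ, hκ, hbκ⟩ := exists_tendsto_pochSeq_div hx hsum
  simp only [hcard, Nat.cast_ofNat, div_self (two_ne_zero (α := ℝ)), Real.rpow_neg_one,
    div_inv_eq_mul, mul_comm (pochSeq s x _)] at hbκ
  have ha := hb.tendsto_coeff_recipDefect_div_logWeight hκ hbκ
    (coeff_eulerDiff_pochSeq_nonneg hx hsum hcard) (isBigO_coeff_eulerDiff_pochSeq hsum hcard hbκ)
  have hw0 : Tendsto (fun n : ℕ => ((n : ℝ) + 1) * (logWeight n / ((n : ℝ) + 1))) atTop (𝓝 0) :=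
    tendsto_logWeight.congr fun n => by field_simp
  exact hb.exists_tendsto_coeff_expSeries_quotSeries_div (harmSeq_zero s x) hh.monotone hhL
    isTempered_logWeight.div_succ
    (hb.summable_of_tendsto_coeff_recipDefect_div (inv_pos.2 hκ).ne' ha) hw0 (inv_pos.2 hκ) ha
    (tendsto_sub_harmSeq_mul_pochSeq_div_logWeight hx hhL hL hbκ)

end TwoParameters

section Arithmetic

/-- The sum of `1 / n` over the positive integers `n ≤ X` divisible by no element of `P`. -/
def sieveSum (P : Finset ℕ) (X : ℕ) : ℝ :=
  ∑ n ∈ Finset.Icc 1 X with ∀ p ∈ P, ¬ p ∣ n, 1 / (n : ℝ)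

lemma sum_Icc_one_eq_sum_range {M : Type*} [AddCommMonoid M] (f : ℕ → M) (X : ℕ) :
    ∑ n ∈ Finset.Icc 1 X, f n = ∑ n ∈ range X, f (n + 1) := by
  rw [Finset.range_eq_Ico, Finset.sum_Ico_add' f 0 X 1]
  rfl

lemma sieveSum_empty (X : ℕ) : sieveSum ∅ X = harmonic X := by
  simp [sieveSum, sum_Icc_one_eq_sum_range, harmonic]

lemma sum_one_div_filter_dvd {P : Finset ℕ} {q : ℕ} (hq : 0 < q)
    (hqP : ∀ p ∈ P, p.Coprime q) (X : ℕ) :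
    ∑ n ∈ Finset.Icc 1 X with (∀ p ∈ P, ¬ p ∣ n) ∧ q ∣ n, 1 / (n : ℝ) =
      1 / q * sieveSum P (X / q) := by
  have himage : {n ∈ Finset.Icc 1 X | (∀ p ∈ P, ¬ p ∣ n) ∧ q ∣ n} =
      {n ∈ Finset.Icc 1 (X / q) | ∀ p ∈ P, ¬ p ∣ n}.image (q * ·) := by
    ext n
    simp only [Finset.mem_filter, Finset.mem_Icc, Finset.mem_image, Nat.le_div_iff_mul_le hq]
    constructor
    · rintro ⟨⟨hn, hnX⟩, hnP, m, rfl⟩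
      exact ⟨m, ⟨⟨Nat.pos_of_mul_pos_left hn, mul_comm q m ▸ hnX⟩,
        fun p hp hpm => hnP p hp (hpm.mul_left q)⟩, rfl⟩
    · rintro ⟨m, ⟨⟨hm, hmX⟩, hmP⟩, rfl⟩
      exact ⟨⟨Nat.mul_pos hq hm, mul_comm q m ▸ hmX⟩,
        fun p hp hpm => hmP p hp ((hqP p hp).dvd_of_dvd_mul_left hpm), dvd_mul_right q m⟩
  rw [himage, Finset.sum_image fun m _ n _ => Nat.eq_of_mul_eq_mul_left hq, sieveSum,
    Finset.mul_sum]
  exact Finset.sum_congr rfl fun m _ => by rw [Nat.cast_mul, one_div_mul_one_div]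

lemma sieveSum_insert {P : Finset ℕ} {q : ℕ} (hq : 0 < q) (hqP : ∀ p ∈ P, p.Coprime q) (X : ℕ) :
    sieveSum (insert q P) X = sieveSum P X - 1 / q * sieveSum P (X / q) := by
  rw [eq_sub_iff_add_eq, ← sum_one_div_filter_dvd hq hqP, sieveSum, sieveSum,
    ← Finset.sum_filter_not_add_sum_filter {n ∈ Finset.Icc 1 X | ∀ p ∈ P, ¬ p ∣ n} (q ∣ ·),
    Finset.filter_filter, Finset.filter_filter]
  simp only [Finset.forall_mem_insert, and_comm]

lemma tendsto_log_div_sub_log {q : ℕ} (hq : 0 < q) :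
    Tendsto (fun X : ℕ => Real.log ((X / q : ℕ) : ℝ) - Real.log X) atTop (𝓝 (-Real.log q)) := by
  have hfloor := (tendsto_nat_floor_mul_div_atTop (R := ℝ) (a := (q : ℝ)⁻¹) (by positivity)).comp
    tendsto_natCast_atTop_atTop
  have hlog := hfloor.log (by positivity)
  rw [Real.log_inv] at hlog
  refine hlog.congr' ?_
  filter_upwards [eventually_ge_atTop q] with X hX
  have hdiv : ((X / q : ℕ) : ℝ) ≠ 0 := by exact_mod_cast (Nat.div_pos hX hq).ne'
  have hX0 : (X : ℝ) ≠ 0 := by exact_mod_cast (hq.trans_le hX).ne'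
  rw [Function.comp, mul_comm, ← div_eq_mul_inv, Nat.floor_div_eq_div, Real.log_div hdiv hX0]

lemma tendsto_sieveSum_sub {P : Finset ℕ} (hP : ∀ p ∈ P, p.Prime) :
    Tendsto (fun X : ℕ => sieveSum P X - (∏ p ∈ P, (1 - (p : ℝ)⁻¹)) * Real.log X) atTop
      (𝓝 ((∏ p ∈ P, (1 - (p : ℝ)⁻¹)) * (Real.eulerMascheroniConstant +
        ∑ p ∈ P, Real.log p / ((p : ℝ) - 1)))) := by
  induction P using Finset.induction_on with
  | empty =>
    simpa only [Finset.prod_empty, Finset.sum_empty, one_mul, add_zero, sieveSum_empty] using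
      Real.tendsto_harmonic_sub_log
  | insert q P hqP ih =>
    obtain ⟨hq, hP'⟩ := Finset.forall_mem_insert _ _ _ |>.1 hP
    have hcop : ∀ p ∈ P, p.Coprime q := fun p hp =>
      (Nat.coprime_primes (hP' p hp) hq).2 (ne_of_mem_of_not_mem hp hqP)
    have hq1 : (1 : ℝ) < q := by exact_mod_cast hq.one_lt
    have hdiv := ((ih hP').comp (Nat.tendsto_div_const_atTop hq.ne_zero)).add
      ((tendsto_log_div_sub_log hq.pos).const_mul (∏ p ∈ P, (1 - (p : ℝ)⁻¹)))
    convert (ih hP').sub (hdiv.const_mul (1 / (q : ℝ))) using 1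
    · funext X
      rw [sieveSum_insert hq.pos hcop, Finset.prod_insert hqP, Function.comp]
      ring
    · rw [Finset.prod_insert hqP, Finset.sum_insert hqP]
      have : (q : ℝ) - 1 ≠ 0 := (sub_pos.2 hq1).ne'
      have : (q : ℝ) ≠ 0 := (one_pos.trans hq1).ne'
      congr 1
      field_simp
      ring

lemma coprime_iff_forall_primeFactors {n N : ℕ} (hN : N ≠ 0) :
    Nat.Coprime n N ↔ ∀ p ∈ N.primeFactors, ¬ p ∣ n := by
  refine ⟨fun h p hp hpn => Nat.not_coprime_of_dvd_of_dvd (Nat.prime_of_mem_primeFactors hp).one_lt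
    hpn (Nat.dvd_of_mem_primeFactors hp) h, fun h => Nat.coprime_of_dvd fun p hp hpn hpN => ?_⟩
  exact h p (Nat.mem_primeFactors.2 ⟨hp, hpN, hN⟩) hpn

lemma sieveSum_primeFactors_succ_mul {N : ℕ} (hN : N ≠ 0) (m : ℕ) :
    sieveSum N.primeFactors ((m + 1) * N) = sieveSum N.primeFactors (m * N) +
      ∑ r ∈ residues N, 1 / ((r : ℝ) + m * N) := by
  simp only [sieveSum, residues, Finset.sum_filter, ← coprime_iff_forall_primeFactors hN,
    sum_Icc_one_eq_sum_range]
  rw [add_mul, one_mul, Finset.sum_range_add]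
  congr 1
  refine Finset.sum_congr rfl fun n _ => ?_
  simp only [add_assoc, Nat.coprime_mul_right_add_left]
  push_cast
  rw [add_comm ((m : ℝ) * N)]

lemma harm_div_succ {N : ℕ} (hN : N ≠ 0) (r : ℝ) (m : ℕ) :
    harm (r / N) (m + 1) = harm (r / N) m + N * (1 / (r + m * N)) := by
  have hN0 : (N : ℝ) ≠ 0 := by exact_mod_cast hN
  rw [harm, harm, Finset.sum_range_succ, div_add' _ _ _ hN0, one_div_div, mul_one_div]

lemma sum_harm_residues {N : ℕ} (hN : N ≠ 0) (m : ℕ) :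
    ∑ r ∈ residues N, harm ((r : ℝ) / N) m = N * sieveSum N.primeFactors (m * N) := by
  induction m with
  | zero => simp [harm, sieveSum]
  | succ m ih =>
    simp only [harm_div_succ hN, Finset.sum_add_distrib, ih, ← Finset.mul_sum,
      sieveSum_primeFactors_succ_mul hN, mul_add]

lemma log_C1 {N : ℕ} (hN : N ≠ 0) :
    Real.log (C1 N) = N.totient * (Real.log N +
      ∑ p ∈ N.primeFactors, Real.log p / ((p : ℝ) - 1)) := by
  have hpow : ∀ p ∈ N.primeFactors, ((p ^ (N.totient / (p - 1)) : ℕ) : ℝ) ≠ 0 := fun p hp => by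
    exact_mod_cast pow_ne_zero _ (Nat.prime_of_mem_primeFactors hp).ne_zero
  have hlog : ∀ p ∈ N.primeFactors, Real.log ((p ^ (N.totient / (p - 1)) : ℕ) : ℝ) =
      N.totient * (Real.log p / ((p : ℝ) - 1)) := fun p hp => by
    have hprime := Nat.prime_of_mem_primeFactors hp
    have hdvd : p - 1 ∣ N.totient := by
      rw [← Nat.totient_prime hprime]
      exact Nat.totient_dvd_of_dvd (Nat.dvd_of_mem_primeFactors hp)
    have hcast : ((p - 1 : ℕ) : ℝ) ≠ 0 := by exact_mod_cast (Nat.sub_pos_of_lt hprime.one_lt).ne'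
    rw [Nat.cast_pow, Real.log_pow, Nat.cast_div hdvd hcast, Nat.cast_pred hprime.pos,
      div_mul_eq_mul_div, mul_div_assoc]
  rw [C1, Nat.cast_mul, Nat.cast_prod, Real.log_mul (by exact_mod_cast pow_ne_zero _ hN)
    (Finset.prod_ne_zero_iff.2 hpow), Real.log_prod hpow, Finset.sum_congr rfl hlog,
    Nat.cast_pow, Real.log_pow, mul_add, Finset.mul_sum]

lemma mul_prod_primeFactors_eq_totient (N : ℕ) :
    (N : ℝ) * ∏ p ∈ N.primeFactors, (1 - (p : ℝ)⁻¹) = N.totient := by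
  have hcast := congrArg (Rat.cast : ℚ → ℝ) (Nat.totient_eq_mul_prod_factors N)
  push_cast at hcast
  exact hcast.symm

lemma harm_one (m : ℕ) : harm 1 m = harmonic m := by
  simp [harm, harmonic, add_comm]

lemma tendsto_H1 {N : ℕ} (hN : N ≠ 0) : Tendsto (H1 N) atTop (𝓝 (Real.log (C1 N))) := by
  have hN0 : (N : ℝ) ≠ 0 := by exact_mod_cast hN
  have hsieve := ((tendsto_sieveSum_sub fun p => Nat.prime_of_mem_primeFactors (n := N)).comp
    (tendsto_id.atTop_mul_const' (Nat.pos_of_ne_zero hN))).const_mul (N : ℝ)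
  have hdiff := (hsieve.sub (Real.tendsto_harmonic_sub_log.const_mul (N.totient : ℝ))).add_const
    (N.totient * Real.log N)
  rw [← mul_assoc, mul_prod_primeFactors_eq_totient, mul_add, add_sub_cancel_left, add_comm,
    ← mul_add, ← log_C1 hN] at hdiff
  refine hdiff.congr' ?_
  filter_upwards [eventually_ne_atTop 0] with m hm
  have hm0 : (m : ℝ) ≠ 0 := by exact_mod_cast hm
  rw [H1, sum_harm_residues hN, harm_one, Function.comp, id, mul_sub, ← mul_assoc,
    mul_prod_primeFactors_eq_totient, Nat.cast_mul, Real.log_mul hm0 hN0]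
  ring

lemma pos_of_mem_residues {N r : ℕ} (hr : r ∈ residues N) : 0 < r :=
  (Finset.mem_Icc.1 (Finset.mem_filter.1 hr).1).1

lemma lt_of_mem_residues {N r : ℕ} (hN : N ≠ 1) (hr : r ∈ residues N) : r < N := by
  obtain ⟨hIcc, hcop⟩ := Finset.mem_filter.1 hr
  refine (Finset.mem_Icc.1 hIcc).2.lt_of_ne ?_
  rintro rfl
  exact hN ((Nat.coprime_self r).1 hcop)

lemma card_residues (N : ℕ) : (residues N).card = N.totient := by
  rw [← Nat.filter_coprime_Ico_eq_totient N 1, residues, add_comm 1]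
  simp only [Nat.coprime_comm]
  rfl

lemma sub_mem_residues {N r : ℕ} (hN : N ≠ 1) (hr : r ∈ residues N) : N - r ∈ residues N := by
  have hpos := pos_of_mem_residues hr
  have hlt := lt_of_mem_residues hN hr
  exact Finset.mem_filter.2 ⟨Finset.mem_Icc.2 ⟨by omega, by omega⟩,
    (Nat.coprime_self_sub_left hlt.le).2 (Finset.mem_filter.1 hr).2⟩

lemma sum_residues {N : ℕ} (hN : N ≠ 1) :
    ∑ r ∈ residues N, (r : ℝ) / N = (N.totient : ℝ) / 2 := by
  have hle : ∀ r ∈ residues N, r ≤ N := fun r hr => (lt_of_mem_residues hN hr).le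
  have hreflect : ∑ r ∈ residues N, (r : ℝ) / N = ∑ r ∈ residues N, (1 - (r : ℝ) / N) := by
    refine Finset.sum_nbij' (N - ·) (N - ·) (fun r => sub_mem_residues hN)
      (fun r => sub_mem_residues hN) (fun r hr => Nat.sub_sub_self (hle r hr))
      (fun r hr => Nat.sub_sub_self (hle r hr)) fun r hr => ?_
    have hN0 : (N : ℝ) ≠ 0 := by
      exact_mod_cast ((pos_of_mem_residues hr).trans_le (hle r hr)).ne'
    rw [Nat.cast_sub (hle r hr), sub_div, div_self hN0, sub_sub_cancel]
  rw [Finset.sum_sub_distrib, Finset.sum_const, card_residues, nsmul_eq_mul, mul_one] at hreflect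
  linarith

end Arithmetic

section Catalan

variable {ι : Type*} {i : ι} {x : ι → ℝ}

/-- The generating function of the Catalan numbers, rescaled to radius of convergence `1`. -/
def scaledCatalan : ℝ⟦X⟧ := rescale (1 / 4) (catalanSeries.map (Nat.castRingHom ℝ))

lemma coeff_scaledCatalan (n : ℕ) : coeff n scaledCatalan = (catalan n : ℝ) / 4 ^ n := by
  simp [scaledCatalan, coeff_rescale, div_eq_inv_mul]

lemma coeff_ofNat_mul (k : ℕ) [k.AtLeastTwo] (f : ℝ⟦X⟧) (n : ℕ) :
    coeff n (OfNat.ofNat k * f) = OfNat.ofNat k * coeff n f := by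
  rw [← map_ofNat PowerSeries.C k, coeff_C_mul]

lemma ofNat_ne_zero (k : ℕ) [k.AtLeastTwo] : (OfNat.ofNat k : ℝ⟦X⟧) ≠ 0 := by
  rw [← map_ofNat PowerSeries.C k]
  exact (map_ne_zero_iff _ C_injective).2 (OfNat.ofNat_ne_zero k)

lemma scaledCatalan_eq : 4 * (scaledCatalan - 1) = X * scaledCatalan ^ 2 := by
  have hcat := congrArg (fun f => rescale (1 / 4 : ℝ) (f.map (Nat.castRingHom ℝ)))
    catalanSeries_sq_mul_X_add_one
  simp only [map_add, map_mul, map_pow, map_one, map_X, rescale_X] at hcat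
  have hfour : 4 * PowerSeries.C (1 / 4 : ℝ) = 1 := by
    rw [← map_ofNat PowerSeries.C 4, ← map_mul]
    norm_num
  rw [← scaledCatalan] at hcat
  linear_combination -4 * hcat + scaledCatalan ^ 2 * X * hfour

lemma coeff_scaledCatalan_sq (n : ℕ) :
    coeff n (scaledCatalan ^ 2) = (catalan (n + 1) : ℝ) / 4 ^ n := by
  rw [← coeff_succ_X_mul, ← scaledCatalan_eq, coeff_ofNat_mul, map_sub, coeff_scaledCatalan,
    coeff_one, if_neg n.succ_ne_zero, sub_zero, pow_succ]
  field_simp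

lemma catalan_div_four_pow (n : ℕ) :
    (catalan n : ℝ) / 4 ^ n = n.centralBinom / 4 ^ n / ((n : ℝ) + 1) := by
  rw [← succ_mul_catalan_eq_centralBinom]
  push_cast
  field_simp

lemma pochSeq_singleton_half (hx : x i = 1 / 2) (n : ℕ) :
    pochSeq {i} x n = (n.centralBinom : ℝ) / 4 ^ n := by
  induction n with
  | zero => simp [pochSeq_zero]
  | succ n ih =>
    have hrec : ((n : ℝ) + 1) * (n + 1).centralBinom = 2 * (2 * n + 1) * n.centralBinom := by
      exact_mod_cast Nat.succ_mul_centralBinom_succ n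
    rw [pochSeq_succ, ih, Finset.prod_singleton, hx, pow_succ]
    field_simp
    linarith

lemma coeff_scaledCatalan_eq_pochSeq_div (hx : x i = 1 / 2) (n : ℕ) :
    coeff n scaledCatalan = pochSeq {i} x n / ((n : ℝ) + 1) := by
  rw [coeff_scaledCatalan, catalan_div_four_pow, pochSeq_singleton_half hx]

lemma mk_pochSeq_eq_scaledCatalan_add (hx : x i = 1 / 2) :
    mk (pochSeq {i} x) = scaledCatalan + X * d⁄dX ℝ scaledCatalan := by
  ext n
  rw [map_add, coeff_X_mul_derivative, coeff_mk, coeff_scaledCatalan_eq_pochSeq_div hx]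
  field_simp
  ring

lemma derivative_mk_pochSeq_half (hx : x i = 1 / 2) :
    2 * ((1 - X) * d⁄dX ℝ (mk (pochSeq {i} x))) = mk (pochSeq {i} x) := by
  ext n
  rw [coeff_ofNat_mul, sub_mul, one_mul, map_sub, coeff_X_mul_derivative, coeff_derivative,
    coeff_mk, coeff_mk, pochSeq_succ, Finset.prod_singleton, hx]
  field_simp
  ring

lemma derivative_mk_harmSeq_mul_pochSeq_half (hx : x i = 1 / 2) :
    2 * ((1 - X) * d⁄dX ℝ (mk fun n => harmSeq {i} x n * pochSeq {i} x n)) =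
      (mk fun n => harmSeq {i} x n * pochSeq {i} x n) + scaledCatalan := by
  ext n
  rw [coeff_ofNat_mul, sub_mul, one_mul, map_sub, coeff_X_mul_derivative, coeff_derivative,
    map_add, coeff_mk, coeff_mk, coeff_scaledCatalan_eq_pochSeq_div hx, pochSeq_succ, harmSeq_succ,
    Finset.prod_singleton, Finset.sum_singleton, hx]
  field_simp
  ring

lemma derivative_quotSeries_half_mul (hx : x i = 1 / 2) :
    2 * ((1 - X) * mk (pochSeq {i} x) * d⁄dX ℝ (quotSeries (pochSeq {i} x) (harmSeq {i} x))) =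
      scaledCatalan := by
  have hquot : quotSeries (pochSeq {i} x) (harmSeq {i} x) * mk (pochSeq {i} x) =
      mk fun n => harmSeq {i} x n * pochSeq {i} x n := by
    rw [quotSeries, mul_assoc, mul_comm _ (mk (pochSeq {i} x)),
      mk_mul_inv_mk (pochSeq_zero {i} x), mul_one]
  have hderiv := congrArg (d⁄dX ℝ) hquot
  rw [Derivation.leibniz, smul_eq_mul, smul_eq_mul] at hderiv
  linear_combination 2 * (1 - X) * hderiv + derivative_mk_harmSeq_mul_pochSeq_half hx -
    quotSeries (pochSeq {i} x) (harmSeq {i} x) * derivative_mk_pochSeq_half hx - hquot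

lemma derivative_scaledCatalan_eq :
    4 * d⁄dX ℝ scaledCatalan =
      scaledCatalan ^ 2 + 2 * X * scaledCatalan * d⁄dX ℝ scaledCatalan := by
  have hfour : d⁄dX ℝ (4 : ℝ⟦X⟧) = 0 := by rw [← map_ofNat PowerSeries.C 4, derivative_C]
  have hderiv := congrArg (d⁄dX ℝ) scaledCatalan_eq
  simp only [sq, Derivation.leibniz, smul_eq_mul, map_sub, derivative_one, derivative_X,
    hfour] at hderiv
  linear_combination hderiv

lemma mk_pochSeq_half_mul (hx : x i = 1 / 2) :
    mk (pochSeq {i} x) * (2 - X * scaledCatalan) = 2 := by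
  refine mul_left_cancel₀ (ofNat_ne_zero 2) ?_
  linear_combination 2 * (2 - X * scaledCatalan) * mk_pochSeq_eq_scaledCatalan_add hx +
    X * derivative_scaledCatalan_eq + scaledCatalan_eq

lemma mk_pochSeq_half_sq_mul (hx : x i = 1 / 2) : mk (pochSeq {i} x) ^ 2 * (1 - X) = 1 := by
  refine mul_left_cancel₀ (ofNat_ne_zero 4) ?_
  linear_combination (mk (pochSeq {i} x) * (2 - X * scaledCatalan) + 2) * mk_pochSeq_half_mul hx +
    mk (pochSeq {i} x) ^ 2 * X * scaledCatalan_eq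

lemma derivative_scaledCatalan_sq (hx : x i = 1 / 2) :
    d⁄dX ℝ (scaledCatalan ^ 2) =
      d⁄dX ℝ (quotSeries (pochSeq {i} x) (harmSeq {i} x)) * scaledCatalan ^ 2 := by
  have hcat : 4 * d⁄dX ℝ scaledCatalan = mk (pochSeq {i} x) * scaledCatalan ^ 2 := by
    linear_combination mk (pochSeq {i} x) * derivative_scaledCatalan_eq -
      2 * d⁄dX ℝ scaledCatalan * mk_pochSeq_half_mul hx
  have hquot : 2 * d⁄dX ℝ (quotSeries (pochSeq {i} x) (harmSeq {i} x)) =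
      scaledCatalan * mk (pochSeq {i} x) := by
    linear_combination mk (pochSeq {i} x) * derivative_quotSeries_half_mul hx -
      2 * d⁄dX ℝ (quotSeries (pochSeq {i} x) (harmSeq {i} x)) * mk_pochSeq_half_sq_mul hx
  refine mul_left_cancel₀ (ofNat_ne_zero 4) ?_
  rw [sq, Derivation.leibniz, smul_eq_mul]
  linear_combination 2 * scaledCatalan * hcat - 2 * scaledCatalan ^ 2 * hquot

theorem expSeries_quotSeries_half (hx : x i = 1 / 2) :
    expSeries (quotSeries (pochSeq {i} x) (harmSeq {i} x)) = scaledCatalan ^ 2 := by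
  have hg : constantCoeff (quotSeries (pochSeq {i} x) (harmSeq {i} x)) = 0 :=
    constantCoeff_quotSeries (harmSeq_zero {i} x)
  have hcat : constantCoeff (scaledCatalan ^ 2) = 1 := by
    rw [← coeff_zero_eq_constantCoeff_apply, coeff_scaledCatalan_sq]
    simp
  have hexp := constantCoeff_expSeries hg
  exact eq_of_derivative_eq_mul (derivative_expSeries hg) (derivative_scaledCatalan_sq hx)
    (hexp.trans hcat.symm) (hexp.trans_ne one_ne_zero)

lemma tendsto_catalan_div :
    Tendsto (fun n : ℕ => (catalan (n + 1) : ℝ) / 4 ^ n / ((n : ℝ) + 1) ^ (-(3 / 2 : ℝ))) atTop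
      (𝓝 (4 / √Real.pi)) := by
  have hbinom : Tendsto (fun n : ℕ => (n.centralBinom : ℝ) / 4 ^ n * ((n : ℝ) + 1) ^ (1 / 2 : ℝ))
      atTop (𝓝 (√Real.pi)⁻¹) := by
    have hpoch := tendsto_ascPochhammer_div_factorial (y := 1 / 2) (by norm_num)
    rw [Real.Gamma_one_half_eq] at hpoch
    refine hpoch.congr fun n => ?_
    rw [← pochSeq_singleton_half (i := ()) (x := fun _ => 1 / 2) rfl, pochSeq,
      Finset.prod_singleton]
    norm_num
  have hratio := (tendsto_natCast_div_natCast_add_one.comp (tendsto_add_atTop_nat 1)).rpow_const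
    (p := 3 / 2) (Or.inl one_ne_zero)
  rw [Real.one_rpow] at hratio
  have hprod := ((hbinom.comp (tendsto_add_atTop_nat 1)).mul hratio).const_mul 4
  rw [mul_one, ← div_eq_mul_inv] at hprod
  refine hprod.congr fun n => ?_
  have hpow : ((n : ℝ) + 1 + 1) ^ (3 / 2 : ℝ) =
      ((n : ℝ) + 1 + 1) * ((n : ℝ) + 1 + 1) ^ (1 / 2 : ℝ) := by
    rw [← Real.rpow_one_add' (by positivity) (by norm_num)]
    norm_num
  have hcat : (catalan (n + 1) : ℝ) / 4 ^ n =
      4 * ((n + 1).centralBinom / 4 ^ (n + 1) / ((n : ℝ) + 1 + 1)) := by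
    rw [← Nat.cast_add_one, ← catalan_div_four_pow, pow_succ]
    field_simp
  rw [hcat, Function.comp, Function.comp, Nat.cast_add_one,
    Real.div_rpow (by positivity) (by positivity), hpow, Real.rpow_neg (by positivity)]
  field_simp

end Catalan

section Coordinate

variable {k : ℕ} {N : Fin k → ℕ}

/-- The index set of the parameters `r / N_j` occurring in `B_N`. -/
def paramSet (N : Fin k → ℕ) : Finset (Σ _ : Fin k, ℕ) :=
  Finset.univ.sigma fun j => residues (N j)

/-- The parameter `r / N_j` attached to the index `(j, r)`. -/
def param (N : Fin k → ℕ) (i : Σ _ : Fin k, ℕ) : ℝ := (i.2 : ℝ) / (N i.1 : ℝ)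

lemma card_paramSet (N : Fin k → ℕ) : (paramSet N).card = Phi N := by
  simp only [paramSet, Finset.card_sigma, card_residues, Phi]

lemma sum_param (hN : ∀ j, 2 ≤ N j) :
    ∑ i ∈ paramSet N, param N i = ((paramSet N).card : ℝ) / 2 := by
  rw [card_paramSet, paramSet, Finset.sum_sigma, Phi, Nat.cast_sum, Finset.sum_div]
  exact Finset.sum_congr rfl fun j _ => sum_residues (Nat.ne_of_gt (hN j))

lemma param_pos : ∀ i ∈ paramSet N, 0 < param N i := fun i hi => by
  obtain ⟨hIcc, -⟩ := Finset.mem_filter.1 (Finset.mem_sigma.1 hi).2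
  obtain ⟨hpos, hle⟩ := Finset.mem_Icc.1 hIcc
  exact div_pos (by exact_mod_cast hpos) (by exact_mod_cast hpos.trans hle)

lemma param_lt_one (hN : ∀ j, 2 ≤ N j) : ∀ i ∈ paramSet N, param N i < 1 := fun i hi => by
  have hlt := lt_of_mem_residues (Nat.ne_of_gt (hN i.1)) (Finset.mem_sigma.1 hi).2
  exact (div_lt_one (by exact_mod_cast pos_of_gt hlt)).2 (by exact_mod_cast hlt)

lemma B_eq_pow_mul_pochSeq (N : Fin k → ℕ) (m : ℕ) :
    B N m = (C N : ℝ) ^ m * pochSeq (paramSet N) (param N) m := by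
  simp only [B, B1, C, pochSeq, paramSet, Finset.prod_sigma, Finset.prod_mul_distrib, param,
    Nat.cast_prod, Finset.prod_pow]

lemma H_eq_harmSeq (N : Fin k → ℕ) (m : ℕ) : H N m = harmSeq (paramSet N) (param N) m := by
  rw [harmSeq, paramSet, Finset.sum_sigma, H]
  refine Finset.sum_congr rfl fun j _ => ?_
  rw [H1, Finset.sum_sub_distrib, Finset.sum_const, card_residues, nsmul_eq_mul]
  rfl

lemma C_pos (N : Fin k → ℕ) : (0 : ℝ) < C N := by
  have hC1 : ∀ n : ℕ, 0 < C1 n := fun n => by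
    refine Nat.mul_pos ?_ (Finset.prod_pos fun p hp =>
      pow_pos (Nat.prime_of_mem_primeFactors hp).pos _)
    rcases n.eq_zero_or_pos with rfl | hn
    · simp
    · exact pow_pos hn _
  exact_mod_cast Finset.prod_pos fun j _ => hC1 (N j)

lemma tendsto_harmSeq_param (hN : ∀ j, 2 ≤ N j) :
    Tendsto (harmSeq (paramSet N) (param N)) atTop (𝓝 (Real.log (C N))) := by
  have hC := (C_pos N).ne'
  rw [C, Nat.cast_prod] at hC ⊢
  rw [Real.log_prod (Finset.prod_ne_zero_iff.1 hC)]
  exact (tendsto_finsetSum _ fun j _ => tendsto_H1 (pos_of_gt (hN j)).ne').congr (H_eq_harmSeq N)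

lemma isKaluza_pochSeq_param (hN : ∀ j, 2 ≤ N j) : IsKaluza (pochSeq (paramSet N) (param N)) :=
  isKaluza_pochSeq param_pos fun i hi => (param_lt_one hN i hi).le

lemma strictMono_harmSeq_param (hN : ∀ j, 2 ≤ N j) (hΦ : 0 < Phi N) :
    StrictMono (harmSeq (paramSet N) (param N)) :=
  strictMono_harmSeq (Finset.card_pos.1 (card_paramSet N ▸ hΦ)) param_pos (param_lt_one hN)

lemma harmSeq_param_le (hN : ∀ j, 2 ≤ N j) (hΦ : 0 < Phi N) (n : ℕ) :
    harmSeq (paramSet N) (param N) n ≤ Real.log (C N) :=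
  (strictMono_harmSeq_param hN hΦ).monotone.ge_of_tendsto (tendsto_harmSeq_param hN) n

/-- The power series of `exp (G_N / F_N)` in the rescaled variable `C_N z`. -/
def expRatioSeries (N : Fin k → ℕ) : ℝ⟦X⟧ :=
  expSeries (quotSeries (pochSeq (paramSet N) (param N)) (harmSeq (paramSet N) (param N)))

/-- The Taylor series of `q_N` at `0`, constructed formally. -/
def qSeries (N : Fin k → ℕ) : ℝ⟦X⟧ := X * rescale (C N : ℝ) (expRatioSeries N)

lemma coeff_zero_qSeries (N : Fin k → ℕ) : coeff 0 (qSeries N) = 0 := coeff_zero_X_mul _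

lemma coeff_succ_qSeries (N : Fin k → ℕ) (n : ℕ) :
    coeff (n + 1) (qSeries N) = C N ^ n * coeff n (expRatioSeries N) := by
  rw [qSeries, coeff_succ_X_mul, coeff_rescale]

lemma coeff_succ_qSeries_mul (N : Fin k → ℕ) (n : ℕ) :
    coeff (n + 1) (qSeries N) * (1 / C N : ℝ) ^ (n + 1) = coeff n (expRatioSeries N) / C N := by
  have hC := (C_pos N).ne'
  rw [coeff_succ_qSeries, pow_succ, div_pow, one_pow]
  field_simp

lemma coeff_qSeries_nonneg (hN : ∀ j, 2 ≤ N j) (hΦ : 0 < Phi N) (n : ℕ) :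
    0 ≤ coeff n (qSeries N) := by
  rcases n with _ | n
  · exact (coeff_zero_qSeries N).ge
  · rw [coeff_succ_qSeries]
    exact mul_nonneg (pow_nonneg (C_pos N).le n)
      ((isKaluza_pochSeq_param hN).coeff_expSeries_quotSeries_nonneg (harmSeq_zero _ _)
        (strictMono_harmSeq_param hN hΦ).monotone n)

lemma sum_coeff_qSeries_mul_pow_le_one (hN : ∀ j, 2 ≤ N j) (hΦ : 0 < Phi N) (n : ℕ) :
    ∑ i ∈ range n, coeff i (qSeries N) * (1 / C N : ℝ) ^ i ≤ 1 := by
  rcases n with _ | n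
  · simp
  have hsum := (isKaluza_pochSeq_param hN).sum_coeff_expSeries_quotSeries_le (harmSeq_zero _ _)
    (strictMono_harmSeq_param hN hΦ).monotone (harmSeq_param_le hN hΦ) n
  rw [Real.exp_log (C_pos N)] at hsum
  rw [Finset.sum_range_succ', coeff_zero_qSeries, zero_mul, add_zero]
  simp only [coeff_succ_qSeries_mul]
  rw [← Finset.sum_div]
  exact (div_le_one (C_pos N)).2 hsum

lemma F_eq_tsum (N : Fin k → ℕ) (z : ℂ) :
    F N z = ∑' n, (pochSeq (paramSet N) (param N) n : ℂ) * (C N * z) ^ n := by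
  simp only [F, B_eq_pow_mul_pochSeq, mul_pow]
  push_cast
  exact tsum_congr fun n => by ring

lemma G_eq_tsum (N : Fin k → ℕ) (z : ℂ) :
    G N z = ∑' n, (harmSeq (paramSet N) (param N) n : ℂ) *
      (pochSeq (paramSet N) (param N) n : ℂ) * (C N * z) ^ n := by
  simp only [G, B_eq_pow_mul_pochSeq, H_eq_harmSeq, mul_pow]
  push_cast
  exact tsum_congr fun n => by ring

theorem isSumOn_q (hN : ∀ j, 2 ≤ N j) (hΦ : 0 < Phi N) :
    IsSumOn (complexify (qSeries N)) (q N) (1 / (C N : ℝ)) := by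
  have hexp := (isKaluza_pochSeq_param hN).isSumOn_expSeries_quotSeries (harmSeq_zero _ _)
    (strictMono_harmSeq_param hN hΦ).monotone (harmSeq_param_le hN hΦ)
  have hC : (C N : ℂ) ≠ 0 := by exact_mod_cast (C_pos N).ne'
  have hcomplexify : complexify (qSeries N) =
      X * rescale (C N : ℂ) (complexify (expRatioSeries N)) := by
    rw [qSeries, complexify, map_mul, map_X]
    congr 1
    ext n
    simp [coeff_rescale]
  rw [hcomplexify, ← Complex.norm_natCast]
  refine (IsSumOn.X.mul (hexp.rescale hC)).congr fun z _ => ?_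
  rw [q, F_eq_tsum, G_eq_tsum, id]

lemma tendsto_coeff_qSeries_mul {v : ℕ → ℝ} {a : ℝ}
    (h : Tendsto (fun n => coeff n (expRatioSeries N) * v (n + 1)) atTop (𝓝 a)) :
    Tendsto (fun n => coeff n (qSeries N) * (1 / C N : ℝ) ^ n * v n) atTop (𝓝 (a / C N)) := by
  refine (tendsto_add_atTop_iff_nat 1).1 ((h.div_const _).congr fun n => ?_)
  rw [coeff_succ_qSeries_mul, div_mul_eq_mul_div]

lemma C_eq_four (hN : ∀ j, 2 ≤ N j) (hΦ : Phi N = 1) : C N = 4 := by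
  have htotient : ∀ j, 1 ≤ (N j).totient := fun j => Nat.totient_pos.2 (pos_of_gt (hN j))
  have hk : k ≤ Phi N := by
    simpa [Phi] using Finset.card_nsmul_le_sum Finset.univ _ 1 fun j _ => htotient j
  obtain rfl | rfl : k = 0 ∨ k = 1 := by lia
  · simp [Phi] at hΦ
  have hN0 : N 0 = 2 := by
    rw [Phi, Fin.sum_univ_one, Nat.totient_eq_one_iff] at hΦ
    have := hN 0
    lia
  simp [C, C1, hN0, Nat.prime_two.primeFactors]

theorem coeff_expRatioSeries_of_Phi_eq_one (hN : ∀ j, 2 ≤ N j) (hΦ : Phi N = 1) (n : ℕ) :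
    coeff n (expRatioSeries N) = catalan (n + 1) / 4 ^ n := by
  obtain ⟨i, hi⟩ := Finset.card_eq_one.1 ((card_paramSet N).trans hΦ)
  have hhalf : param N i = 1 / 2 := by simpa [hi] using sum_param hN
  rw [expRatioSeries, hi, expSeries_quotSeries_half hhalf, coeff_scaledCatalan_sq]

variable {a : ℝ}

lemma Phi_pos (hk : 1 ≤ k) (hN : ∀ j, 2 ≤ N j) : 0 < Phi N :=
  Finset.sum_pos (fun j _ => Nat.totient_pos.2 (pos_of_gt (hN j))) ⟨⟨0, hk⟩, Finset.mem_univ _⟩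

lemma tendsto_coeff_qSeries_mul_rpow {s : ℝ}
    (h : Tendsto (fun n : ℕ => coeff n (expRatioSeries N) / ((n : ℝ) + 1) ^ (-s)) atTop (𝓝 a)) :
    Tendsto (fun n : ℕ => coeff n (qSeries N) * (1 / C N : ℝ) ^ n * (n : ℝ) ^ s) atTop
      (𝓝 (a / C N)) :=
  tendsto_coeff_qSeries_mul (h.congr fun n => by
    rw [Real.rpow_neg (by positivity), div_inv_eq_mul, Nat.cast_succ])

lemma tendsto_logWeight_mul_log_succ_sq :
    Tendsto (fun n : ℕ => logWeight n * Real.log (n + 1 : ℕ) ^ 2) atTop (𝓝 1) := by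
  refine (tendsto_add_atTop_iff_nat 1).1 (isTempered_logWeight.ratio.congr fun n => ?_)
  rw [logWeight.eq_1 n, div_div_eq_mul_div, div_one, Nat.cast_add, Nat.cast_add, add_assoc]
  norm_num

lemma tendsto_coeff_qSeries_mul_log
    (h : Tendsto (fun n : ℕ => coeff n (expRatioSeries N) / (logWeight n / ((n : ℝ) + 1))) atTop
      (𝓝 a)) :
    Tendsto (fun n : ℕ => coeff n (qSeries N) * (1 / C N : ℝ) ^ n * (n * Real.log n ^ 2)) atTop
      (𝓝 (a / C N)) := by
  refine tendsto_coeff_qSeries_mul ?_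
  rw [← mul_one a]
  refine (h.mul tendsto_logWeight_mul_log_succ_sq).congr fun n => ?_
  have hw := (logWeight_pos n).ne'
  rw [Nat.cast_succ]
  field_simp

theorem tendsto_coeff_qSeries_of_Phi_eq_one (hN : ∀ j, 2 ≤ N j) (hΦ : Phi N = 1) :
    Tendsto (fun n : ℕ => coeff n (qSeries N) * (1 / C N : ℝ) ^ n * (n : ℝ) ^ (3 / 2 : ℝ)) atTop
      (𝓝 (√Real.pi)⁻¹) := by
  have hlim : 4 / √Real.pi / C N = (√Real.pi)⁻¹ := by
    rw [C_eq_four hN hΦ, Nat.cast_ofNat, div_right_comm, div_self four_ne_zero, one_div]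
  rw [← hlim]
  exact tendsto_coeff_qSeries_mul_rpow <| tendsto_catalan_div.congr fun n => by
    rw [coeff_expRatioSeries_of_Phi_eq_one hN hΦ]

theorem exists_tendsto_coeff_qSeries_of_Phi_eq_two (hN : ∀ j, 2 ≤ N j) (hΦ : Phi N = 2) :
    ∃ c ≠ 0, Tendsto
      (fun n : ℕ => coeff n (qSeries N) * (1 / C N : ℝ) ^ n * (n * Real.log n ^ 2)) atTop
        (𝓝 c) := by
  obtain ⟨c, hc, h⟩ := exists_tendsto_coeff_expSeries_div_logWeight param_pos (param_lt_one hN)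
    (sum_param hN) ((card_paramSet N).trans hΦ) (tendsto_harmSeq_param hN)
  exact ⟨c / C N, (div_pos hc (C_pos N)).ne', tendsto_coeff_qSeries_mul_log h⟩

theorem exists_tendsto_coeff_qSeries_of_three_le_Phi (hN : ∀ j, 2 ≤ N j) (hΦ : 3 ≤ Phi N) :
    ∃ c ≠ 0, Tendsto
      (fun n : ℕ => coeff n (qSeries N) * (1 / C N : ℝ) ^ n * (n : ℝ) ^ ((Phi N : ℝ) / 2)) atTop
        (𝓝 c) := by
  obtain ⟨c, hc, h⟩ := exists_tendsto_coeff_expSeries_div_rpow param_pos (param_lt_one hN)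
    (sum_param hN) (hΦ.trans_eq (card_paramSet N).symm) (tendsto_harmSeq_param hN)
  rw [card_paramSet] at h
  exact ⟨c / C N, (div_pos hc (C_pos N)).ne', tendsto_coeff_qSeries_mul_rpow h⟩

theorem coeff_complexify_qSeries_of_Phi_eq_one (hN : ∀ j, 2 ≤ N j) (hΦ : Phi N = 1) {m : ℕ}
    (hm : 1 ≤ m) : coeff m (complexify (qSeries N)) = (catalan m : ℂ) := by
  obtain ⟨n, rfl⟩ := Nat.exists_eq_add_of_le' hm
  rw [coeff_map, coeff_succ_qSeries, coeff_expRatioSeries_of_Phi_eq_one hN hΦ, C_eq_four hN hΦ,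
    Nat.cast_ofNat, mul_div_cancel₀ _ (by positivity), map_natCast]

theorem isEquivalent_coeff_complexify_qSeries_of_Phi_eq_one (hN : ∀ j, 2 ≤ N j)
    (hΦ : Phi N = 1) : (fun m => coeff m (complexify (qSeries N))) ~[atTop]
      fun m : ℕ => ((4 ^ m / (√Real.pi * (m : ℝ) ^ (3 / 2 : ℝ)) : ℝ) : ℂ) := by
  have h := isEquivalent_coeff_complexify (C_pos N).ne' (by positivity)
    (tendsto_coeff_qSeries_of_Phi_eq_one hN hΦ)
  simpa only [C_eq_four hN hΦ, Nat.cast_ofNat, inv_mul_eq_div, div_div, mul_comm √Real.pi] using h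

lemma isBigO_natCast_rpow_pow {s : ℝ} {j : ℕ} (hs : s ≤ j) :
    (fun n : ℕ => (n : ℝ) ^ s) =O[atTop] fun n : ℕ => (n : ℝ) ^ j := by
  refine .of_bound' ?_
  filter_upwards [eventually_ge_atTop 1] with n hn
  have hn1 : (1 : ℝ) ≤ n := by exact_mod_cast hn
  rw [Real.norm_of_nonneg (by positivity), Real.norm_of_nonneg (by positivity),
    ← Real.rpow_natCast]
  exact Real.rpow_le_rpow_of_exponent_le hn1 hs

lemma isBigO_natCast_mul_log_sq :
    (fun n : ℕ => (n : ℝ) * Real.log n ^ 2) =O[atTop] fun n : ℕ => (n : ℝ) ^ 3 := by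
  have hlog := (Real.isLittleO_log_id_atTop.isBigO.comp_tendsto tendsto_natCast_atTop_atTop).pow 2
  refine ((isBigO_refl (fun n : ℕ => (n : ℝ)) atTop).mul hlog).congr_right fun n => ?_
  simp only [Function.comp_apply, id]
  ring

lemma exists_isBigO_tendsto_coeff_qSeries (hN : ∀ j, 2 ≤ N j) (hΦ : 0 < Phi N) :
    ∃ (v : ℕ → ℝ) (j : ℕ) (c : ℝ), v =O[atTop] (fun n : ℕ => (n : ℝ) ^ j) ∧ c ≠ 0 ∧
      Tendsto (fun n => coeff n (qSeries N) * (1 / C N : ℝ) ^ n * v n) atTop (𝓝 c) := by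
  obtain h1 | h2 | h3 : Phi N = 1 ∨ Phi N = 2 ∨ 3 ≤ Phi N := by lia
  · exact ⟨_, 2, _, isBigO_natCast_rpow_pow (by norm_num), (by positivity),
      tendsto_coeff_qSeries_of_Phi_eq_one hN h1⟩
  · obtain ⟨c, hc, h⟩ := exists_tendsto_coeff_qSeries_of_Phi_eq_two hN h2
    exact ⟨_, 3, c, isBigO_natCast_mul_log_sq, hc, h⟩
  · obtain ⟨c, hc, h⟩ := exists_tendsto_coeff_qSeries_of_three_le_Phi hN h3
    exact ⟨_, Phi N, c, isBigO_natCast_rpow_pow (half_le_self (Nat.cast_nonneg _)), hc, h⟩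

theorem hasSingularityAt_q (hN : ∀ j, 2 ≤ N j) (hΦ : 0 < Phi N) :
    HasSingularityAt (q N) (Metric.ball 0 (1 / (C N : ℝ))) (1 / (C N : ℂ)) := by
  have hR : (0 : ℝ) < 1 / C N := one_div_pos.2 (C_pos N)
  have hcast : (1 / (C N : ℂ)) = ((1 / (C N : ℝ) : ℝ) : ℂ) := by push_cast; rfl
  rw [HasSingularityAt, frontier_ball _ hR.ne', hcast]
  obtain ⟨v, j, c, hv, hc, h⟩ := exists_isBigO_tendsto_coeff_qSeries hN hΦ
  refine ⟨?_, (isSumOn_q hN hΦ).not_exists_analyticAt hR (coeff_qSeries_nonneg hN hΦ) hv hc h⟩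
  rw [mem_sphere_zero_iff_norm, Complex.norm_of_nonneg hR.le]

end Coordinate

end CanonicalCoordinate

end

theorem theorem2 (k : ℕ) (hk : 1 ≤ k) (N : Fin k → ℕ) (hN : ∀ j, 2 ≤ N j) :
    -- (i) the Taylor series represents the function on the open disk, has radius of convergence
    -- `1 / C_N`, and converges (absolutely) on the boundary circle
    (HasFPowerSeriesOnBall (CanonicalCoordinate.q N)
        (CanonicalCoordinate.taylorSeries (CanonicalCoordinate.q N)) 0
        (ENNReal.ofReal (1 / (CanonicalCoordinate.C N : ℝ))) ∧
      (CanonicalCoordinate.taylorSeries (CanonicalCoordinate.q N)).radius =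
        ENNReal.ofReal (1 / (CanonicalCoordinate.C N : ℝ)) ∧
      ∀ z : ℂ, ‖z‖ = 1 / (CanonicalCoordinate.C N : ℝ) →
        Summable (fun m : ℕ =>
          CanonicalCoordinate.taylorCoeff (CanonicalCoordinate.q N) m * z ^ m)) ∧
    -- (ii) singularity at `1 / C_N`
    CanonicalCoordinate.HasSingularityAt (CanonicalCoordinate.q N)
      (Metric.ball 0 (1 / (CanonicalCoordinate.C N : ℝ)))
      (1 / (CanonicalCoordinate.C N : ℂ)) ∧
    -- (iii) the bound by `1` on the closed disk; on the boundary circle the value `w` of the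
    -- function is the sum of the Taylor series, equivalently the limit from inside the disk
    ((∀ z : ℂ, ‖z‖ < 1 / (CanonicalCoordinate.C N : ℝ) → ‖CanonicalCoordinate.q N z‖ ≤ 1) ∧
      ∀ z : ℂ, ‖z‖ = 1 / (CanonicalCoordinate.C N : ℝ) →
        ∃ w : ℂ,
          HasSum (fun m : ℕ =>
            CanonicalCoordinate.taylorCoeff (CanonicalCoordinate.q N) m * z ^ m) w ∧
          Tendsto (CanonicalCoordinate.q N)
            (𝓝[Metric.ball 0 (1 / (CanonicalCoordinate.C N : ℝ))] z) (𝓝 w) ∧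
          ‖w‖ ≤ 1) ∧
    -- (iv)
    (CanonicalCoordinate.Phi N = 1 →
      (∀ m : ℕ, 1 ≤ m →
        CanonicalCoordinate.taylorCoeff (CanonicalCoordinate.q N) m = (catalan m : ℂ)) ∧
      (fun m : ℕ => CanonicalCoordinate.taylorCoeff (CanonicalCoordinate.q N) m) ~[atTop]
        (fun m : ℕ => (((4 : ℝ) ^ m / (√Real.pi * (m : ℝ) ^ ((3 : ℝ) / 2)) : ℝ) : ℂ))) ∧
    -- (v)
    (CanonicalCoordinate.Phi N = 2 →
      ∃ c : ℝ, c ≠ 0 ∧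
        (fun m : ℕ => CanonicalCoordinate.taylorCoeff (CanonicalCoordinate.q N) m) ~[atTop]
          (fun m : ℕ =>
            ((c * ((CanonicalCoordinate.C N : ℝ) ^ m / ((m : ℝ) * Real.log m ^ 2)) : ℝ) : ℂ))) ∧
    -- (vi)
    (3 ≤ CanonicalCoordinate.Phi N →
      ∃ c : ℝ, c ≠ 0 ∧
        (fun m : ℕ => CanonicalCoordinate.taylorCoeff (CanonicalCoordinate.q N) m) ~[atTop]
          (fun m : ℕ =>
            ((c * ((CanonicalCoordinate.C N : ℝ) ^ m /
              (m : ℝ) ^ ((CanonicalCoordinate.Phi N : ℝ) / 2)) : ℝ) : ℂ))) := by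
  open CanonicalCoordinate in
  have hΦ := Phi_pos hk hN
  have hC := C_pos N
  have hR : (0 : ℝ) < 1 / C N := one_div_pos.2 hC
  have hq := isSumOn_q hN hΦ
  have hp := coeff_qSeries_nonneg hN hΦ
  have hle := sum_coeff_qSeries_mul_pow_le_one hN hΦ
  have hsing := hasSingularityAt_q hN hΦ
  have htaylor : taylorCoeff (q N) = fun n => PowerSeries.coeff n (complexify (qSeries N)) :=
    funext (hq.taylorCoeff_eq hR)
  rw [taylorSeries, htaylor]
  refine ⟨⟨hq.hasFPowerSeriesOnBall hR, hq.radius_eq hR (by simp) hsing.2,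
      fun z hz => summable_coeff_complexify_mul_pow hR.le hp hle hz.le⟩, hsing,
    ⟨fun z hz => (hq z hz).tsum_eq ▸ norm_tsum_coeff_complexify_mul_pow_le hR.le hp hle hz.le,
      fun z hz => ⟨_, (summable_coeff_complexify_mul_pow hR.le hp hle hz.le).hasSum,
      hq.tendsto_boundary hp (summable_coeff_mul_pow hR.le hp hle) hz.le,
      norm_tsum_coeff_complexify_mul_pow_le hR.le hp hle hz.le⟩⟩,
    fun h1 => ⟨fun m hm => coeff_complexify_qSeries_of_Phi_eq_one hN h1 hm,
      isEquivalent_coeff_complexify_qSeries_of_Phi_eq_one hN h1⟩, fun h2 => ?_, fun h3 => ?_⟩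
  · obtain ⟨c, hc, h⟩ := exists_tendsto_coeff_qSeries_of_Phi_eq_two hN h2
    exact ⟨c, hc, isEquivalent_coeff_complexify hC.ne' hc h⟩
  · obtain ⟨c, hc, h⟩ := exists_tendsto_coeff_qSeries_of_three_le_Phi hN h3
    exact ⟨c, hc, isEquivalent_coeff_complexify hC.ne' hc h⟩
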